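/- Let $d\ge 1$ and let $\mathscr T_1,\dots,\mathscr T_d$ be locally finite, leafless, rooted directed trees, $\mathscr T_j$ having vertex set $V_j$ and root $\mathsf{root}_j$. Let $\mathscr T$ be their directed Cartesian product, with vertex set $V=V_1\times\cdots\times V_d$. For $v\in V$ let $\mathsf d_v=(\mathsf d_{v_1},\dots,\mathsf d_{v_d})\in\mathbb N^d$ be its depth ($\mathsf d_{v_j}$ is the depth of $v_j$ in $\mathscr T_j$), and let $\mathsf{Chi}_j(v)$ be the set of vertices obtained from $v$ by replacing $v_j$ by one of its children; similarly $\mathsf{sib}_j(v)$, with a sibling of $v_j$ (a child of the parent of $v_j$, $v_j$ included), and $\mathsf{par}_j(v)$, with the parent of $v_j\neq\mathsf{root}_j$. Assume that $\mathscr T$ is of finite joint branching index, i.e. in each $\mathscr T_j$ the depths of the vertices with at least two children are bounded. Let $\mathfrak c:\mathbb N\to(0,\infty)$ satisfy $\inf\mathfrak c>0$ and $\sup\mathfrak c<\infty$, and put $$\lambda_j(w)=\sqrt{\frac{\mathfrak c(|\mathsf d_v|)}{\mathrm{card}(\mathsf{Chi}_j(v))}}\sqrt{\frac{\mathsf d_{v_j}+1}{|\mathsf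 d_v|+d}},\qquad w\in\mathsf{Chi}_j(v),\ v\in V,\ j=1,\dots,d.$$ Let $S_{\lambda_{\mathfrak c}}=(S_1,\dots,S_d)$ be the $d$-tuple of bounded operators on $l^2(V)$ with $(S_jf)(v)=\lambda_j(v)f(\mathsf{par}_j(v))$ if $v_j\ne\mathsf{root}_j$ and $(S_jf)(v)=0$ otherwise, and let $E=\bigcap_{j}\ker S_j^*$. For $F\subseteq\{1,\dots,d\}$ let $\Phi_F$ be the set of those $v\in V$ with $v_j\neq\mathsf{root}_j$ exactly for $j\in F$. For $u\in\Phi_F$ let $\mathsf{sib}_F(u)$ be the set of $v\in V$ such that $v_j$ is a sibling of $u_j$ for $j\in F$ and $v_j=u_j$ for $j\notin F$. Let $\Omega_F\subseteq\Phi_F$ contain exactly one element of each of the classes $\mathsf{sib}_F(u)$, $u\in\Phi_F$. For $u\in\Omega_F$ let $\mathcal L_{u,F}$ be the space of all $f\in l^2(V)$ vanishing off $\mathsf{sib}_F(u)$ with $$\sum_{w\in\mathsf{sib}_j(v')}\lambda_j(w)f(w)=0\qquad\text{for all }j\in F\text{ and }v\in\mathsf{sib}_F(u),$$ where $v'$ is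 $v$ with its $j$-th coordinate replaced by $u_j$. Then $\mathcal L_{u,F}\subseteq E$ for all $F$ and all $u\in\Omega_F$, and there are $r>0$ and a reproducing kernel Hilbert space $\mathscr H_{\mathfrak c}(\mathscr T)$ of $E$-valued holomorphic functions on the open ball $\mathbb B^d_r$ of radius $r$ centred at $0$ in $\mathbb C^d$, on which the multiplications $\mathscr M_{z_1},\dots,\mathscr M_{z_d}$ by the coordinate functions are bounded operators, such that $S_{\lambda_{\mathfrak c}}$ is unitarily equivalent to $(\mathscr M_{z_1},\dots,\mathscr M_{z_d})$: there is one unitary $U:l^2(V)\to\mathscr H_{\mathfrak c}(\mathscr T)$ with $US_j=\mathscr M_{z_j}U$ for all $j$. The $B(E)$-valued reproducing kernel of $\mathscr H_{\mathfrak c}(\mathscr T)$ is $$\kappa(z,w)=\sum_{F\subseteq\{1,\dots,d\}}\ \sum_{u\in\Omega_F}\Big(\sum_{\alpha\in\mathbb N^d}\frac{\mathsf d_u!}{(\mathsf d_u+\alpha)!}\prod_{j=0}^{|\alpha|-1}\frac{|\mathsf d_u|+d+j}{\mathfrak c(|\mathsf d_u|+j)}\,z^\alpha\overline w^\alpha\Big)P_{\mathcal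 L_{u,F}},\qquad z,w\in\mathbb B^d_r,$$ where $P_{\mathcal L_{u,F}}$ is the orthogonal projection of $E$ onto $\mathcal L_{u,F}$; all the series converge (unconditionally) for $z,w\in\mathbb B^d_r$. -/

import Mathlib

open scoped ENNReal NNReal lp

universe u

/-- A rooted directed tree on the vertex set `V`: a directed graph without loops and circuits,
connected (as an undirected graph), having a root (a vertex without parent), and such that every
other vertex has exactly one parent. -/
structure RootedDirectedTree (V : Type u) extends Digraph V where
  root : V
  no_circuit : ∀ v, ¬ Relation.TransGen Adj v v
  connected : ∀ v w, Relation.EqvGen Adj v w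
  root_no_parent : ∀ v, ¬ Adj v root
  existsUnique_parent : ∀ v, v ≠ root → ∃! p, Adj p v

namespace RootedDirectedTree

variable {V : Type u} (T : RootedDirectedTree V)

/-- The children of a vertex. -/
def chi (v : V) : Set V := {w | T.Adj v w}

/-- The children of a set of vertices. -/
def chiSet (W : Set V) : Set V := {w | ∃ v ∈ W, T.Adj v w}

/-- The siblings of a vertex `v` (including `v`): the children of its parent. The root has none. -/
def sib (v : V) : Set V := {w | ∃ p, T.Adj p v ∧ T.Adj p w}

open Classical in
/-- The parent of a vertex (by convention, the root itself for the root). -/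
noncomputable def par (v : V) : V :=
  if h : v = T.root then T.root else (T.existsUnique_parent v h).choose

/-- Every vertex lies in exactly one of the sets `Chi^n(root)`. -/
theorem existsUnique_depth (v : V) : ∃! n : ℕ, v ∈ T.chiSet^[n] {T.root} := by
  have key : ∀ a b, T.Adj a b →
      ((∃ n, a ∈ T.chiSet^[n] {T.root}) ↔ ∃ n, b ∈ T.chiSet^[n] {T.root}) := by
    intro a b hab
    constructor
    · rintro ⟨n, hn⟩
      exact ⟨n + 1, by rw [Function.iterate_succ_apply']; exact ⟨a, hn, hab⟩⟩
    · rintro ⟨n, hn⟩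
      cases n with
      | zero =>
        have hb : b = T.root := hn
        exact absurd (hb ▸ hab) (T.root_no_parent a)
      | succ n =>
        rw [Function.iterate_succ_apply'] at hn
        obtain ⟨a', ha', hab'⟩ := hn
        have hb : b ≠ T.root := fun h => T.root_no_parent a (h ▸ hab)
        exact ⟨n, (T.existsUnique_parent b hb).unique hab' hab ▸ ha'⟩
  have key2 : ∀ a b, Relation.EqvGen T.Adj a b →
      ((∃ n, a ∈ T.chiSet^[n] {T.root}) ↔ ∃ n, b ∈ T.chiSet^[n] {T.root}) := by
    intro a b h
    induction h with
    | rel x y h => exact key x y h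
    | refl x => rfl
    | symm x y _ ih => exact ih.symm
    | trans x y z _ _ ih1 ih2 => exact ih1.trans ih2
  have ex := (key2 _ _ (T.connected T.root v)).1 ⟨0, rfl⟩
  have uniq : ∀ n m : ℕ, ∀ v, v ∈ T.chiSet^[n] {T.root} → v ∈ T.chiSet^[m] {T.root} → n = m := by
    intro n
    induction n with
    | zero =>
      intro m v hv hm
      cases m with
      | zero => rfl
      | succ m =>
        rw [Function.iterate_succ_apply'] at hm
        obtain ⟨a, _, ha⟩ := hm
        have hv' : v = T.root := hv
        exact absurd (hv' ▸ ha) (T.root_no_parent a)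
    | succ n ih =>
      intro m v hv hm
      rw [Function.iterate_succ_apply'] at hv
      obtain ⟨a, ha, hav⟩ := hv
      cases m with
      | zero =>
        have hv' : v = T.root := hm
        exact absurd (hv' ▸ hav) (T.root_no_parent a)
      | succ m =>
        rw [Function.iterate_succ_apply'] at hm
        obtain ⟨b, hb, hbv⟩ := hm
        have hr : v ≠ T.root := fun h => T.root_no_parent a (h ▸ hav)
        have hab := (T.existsUnique_parent v hr).unique hav hbv
        rw [ih m a ha (hab ▸ hb)]
  obtain ⟨n, hn⟩ := ex
  exact ⟨n, hn, fun m hm => uniq m n v hm hn⟩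

/-- The depth of `v`: the unique `n` with `v ∈ Chi^n(root)`. -/
noncomputable def depth (v : V) : ℕ := (T.existsUnique_depth v).choose

/-- The tree is leafless: every vertex has a child. -/
def IsLeafless : Prop := ∀ v, (T.chi v).Nonempty

/-- The tree is locally finite: every vertex has finitely many children. -/
class IsLocallyFinite : Prop where
  finite_chi : ∀ v, (T.chi v).Finite

/-- The branching vertices: those with at least two children. -/
def branching : Set V := {v | 2 ≤ (T.chi v).encard}

open Classical in
/-- The branching index of the tree: `1 + sup` of the depths of the branching vertices if there are
any, and `0` otherwise. -/
noncomputable def branchingIndex : ℕ∞ :=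
  if T.branching.Nonempty then 1 + ⨆ w ∈ T.branching, (T.depth w : ℕ∞) else 0

theorem par_eq {v w : V} (h : T.Adj v w) : T.par w = v := by
  have hw : w ≠ T.root := fun e => T.root_no_parent v (e ▸ h)
  unfold par
  rw [dif_neg hw]
  exact (T.existsUnique_parent w hw).unique (T.existsUnique_parent w hw).choose_spec.1 h

theorem adj_par {w : V} (hw : w ≠ T.root) : T.Adj (T.par w) w := by
  unfold par
  rw [dif_neg hw]
  exact (T.existsUnique_parent w hw).choose_spec.1

theorem finite_sib [T.IsLocallyFinite] (v : V) : (T.sib v).Finite := by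
  refine (IsLocallyFinite.finite_chi (T := T) (T.par v)).subset ?_
  rintro w ⟨p, hp, hw⟩
  rw [T.par_eq hp]
  exact hw

end RootedDirectedTree

/-! ### The directed Cartesian product of a finite family of rooted directed trees

The vertices are the tuples `v = (v_1, …, v_d)`. -/

namespace TreeProduct

variable {d : ℕ} {V : Fin d → Type u} (T : ∀ j, RootedDirectedTree (V j))

/-- The directed Cartesian product has finite joint branching index: all components of its
branching index are finite. -/
def FiniteJointBranchingIndex : Prop := ∀ j, (T j).branchingIndex < ⊤

/-- The depth of a vertex of the product, a multiindex. -/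
noncomputable def depth (v : ∀ j, V j) : Fin d → ℕ := fun j => (T j).depth (v j)

/-- `Chi_j(v)`: replace the `j`-th coordinate by one of its children. -/
def chi (j : Fin d) (v : ∀ j, V j) : Set (∀ j, V j) :=
  {w | w j ∈ (T j).chi (v j) ∧ ∀ i, i ≠ j → w i = v i}

/-- `par_j(v)`: replace the `j`-th coordinate by its parent. -/
noncomputable def par (j : Fin d) (v : ∀ j, V j) : ∀ j, V j :=
  Function.update v j ((T j).par (v j))

/-- `sib_j(v)`: replace the `j`-th coordinate by one of its siblings. -/
def sib (j : Fin d) (v : ∀ j, V j) : Set (∀ j, V j) :=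
  {w | w j ∈ (T j).sib (v j) ∧ ∀ i, i ≠ j → w i = v i}

/-- `Φ_F`: the vertices whose coordinates different from the root are those with index in `F`. -/
def Phi (F : Finset (Fin d)) : Set (∀ j, V j) := {v | ∀ j, j ∈ F ↔ v j ≠ (T j).root}

/-- `sib_F(u) = sib_{i_1} ⋯ sib_{i_k}(u)` for `F = {i_1, …, i_k}`. -/
def sibF (F : Finset (Fin d)) (v : ∀ j, V j) : Set (∀ j, V j) :=
  {w | (∀ j ∈ F, w j ∈ (T j).sib (v j)) ∧ ∀ j, j ∉ F → w j = v j}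

/-- `Ω` is an indexing set for `F`: it contains exactly one element of each of the equivalence
classes `sib_F(v)`, `v ∈ Φ_F`. -/
def IsIndexingSet (F : Finset (Fin d)) (Ω : Set (∀ j, V j)) : Prop :=
  Ω ⊆ Phi T F ∧ ∀ v ∈ Phi T F, ∃! u, u ∈ Ω ∧ u ∈ sibF T F v

open Classical in
/-- `v_G`: the coordinates with index outside `G` are replaced by the roots. -/
noncomputable def restrict (G : Finset (Fin d)) (v : ∀ j, V j) : ∀ j, V j :=
  fun j => if j ∈ G then v j else (T j).root

/-- The Hilbert space `l²(V)`. -/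
abbrev L2 (V : Fin d → Type u) : Type u := ℓ²(∀ j, V j, ℂ)

/-- The map `Λ^{(j)}` on complex functions on the vertices. The weights `lam j v` with
`v j = root` are never used. -/
noncomputable def shiftFun (lam : Fin d → (∀ j, V j) → ℝ) (j : Fin d) (f : (∀ j, V j) → ℂ) :
    (∀ j, V j) → ℂ := by
  classical
  exact fun v => if v j = (T j).root then 0 else (lam j v : ℂ) * f (par T j v)

/-- The condition `sup_v ∑_{w ∈ Chi_j(v)} λ_j(w)² < ∞` for all `j`. -/
def IsBoundedWeights (lam : Fin d → (∀ j, V j) → ℝ) : Prop :=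
  ∃ M : ℝ≥0, ∀ j v, ∑' w : chi T j v, ENNReal.ofReal (lam j w ^ 2) ≤ M

section bounded

variable {T} {lam : Fin d → (∀ j, V j) → ℝ}

theorem tsum_shiftFun_le {M : ℝ≥0}
    (hM : ∀ j v, ∑' w : chi T j v, ENNReal.ofReal (lam j w ^ 2) ≤ M) (j : Fin d)
    (f : (∀ j, V j) → ℂ) :
    ∑' v, ‖shiftFun T lam j f v‖ₑ ^ 2 ≤ M * ∑' v, ‖f v‖ₑ ^ 2 := by
  classical
  rw [← ENNReal.tsum_fiberwise _ (par T j), ← ENNReal.tsum_mul_left]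
  refine ENNReal.tsum_le_tsum fun v => ?_
  calc ∑' b : (par T j) ⁻¹' {v}, ‖shiftFun T lam j f b‖ₑ ^ 2
      = ∑' b, ((par T j) ⁻¹' {v}).indicator (fun b => ‖shiftFun T lam j f b‖ₑ ^ 2) b :=
        tsum_subtype ((par T j) ⁻¹' {v}) (fun b => ‖shiftFun T lam j f b‖ₑ ^ 2)
    _ ≤ ∑' b, (chi T j v).indicator
          (fun b => ENNReal.ofReal (lam j b ^ 2) * ‖f v‖ₑ ^ 2) b := by
        refine ENNReal.tsum_le_tsum fun b => ?_
        by_cases hb : b ∈ (par T j) ⁻¹' {v}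
        · rw [Set.indicator_of_mem hb]
          have hb' : par T j b = v := hb
          by_cases hr : b j = (T j).root
          · simp [shiftFun, hr]
          · have hc : b ∈ chi T j v := by
              subst hb'
              refine ⟨?_, fun i hi => ?_⟩
              · simpa [par, RootedDirectedTree.chi] using (T j).adj_par hr
              · simp [par, hi]
            rw [Set.indicator_of_mem hc]
            simp only [shiftFun, hr, if_false, hb', enorm_mul, mul_pow]
            gcongr
            rw [← ofReal_norm, ← ENNReal.ofReal_pow (norm_nonneg _)]
            simp
        · rw [Set.indicator_of_notMem hb]
          exact zero_le
    _ = ∑' b : chi T j v, ENNReal.ofReal (lam j b ^ 2) * ‖f v‖ₑ ^ 2 := 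
        (tsum_subtype (chi T j v) (fun b => ENNReal.ofReal (lam j b ^ 2) * ‖f v‖ₑ ^ 2)).symm
    _ = (∑' b : chi T j v, ENNReal.ofReal (lam j b ^ 2)) * ‖f v‖ₑ ^ 2 := ENNReal.tsum_mul_right
    _ ≤ M * ‖f v‖ₑ ^ 2 := by gcongr; exact hM j v

theorem memlp_two_iff {ι : Type*} {f : ι → ℂ} : Memℓp f 2 ↔ ∑' v, ‖f v‖ₑ ^ 2 ≠ ⊤ := by
  have h : ∀ v, ‖f v‖ₑ ^ 2 = ((‖f v‖₊ ^ 2 : ℝ≥0) : ℝ≥0∞) := fun v => by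
    rw [ENNReal.coe_pow]; rfl
  simp_rw [h]
  rw [ENNReal.tsum_coe_ne_top_iff_summable_coe, memℓp_gen_iff (by norm_num)]
  simp

theorem ofReal_norm_sq {ι : Type*} (f : ℓ²(ι, ℂ)) :
    ENNReal.ofReal (‖f‖ ^ 2) = ∑' v, ‖f v‖ₑ ^ 2 := by
  have h1 : ‖f‖ ^ 2 = ∑' v, ‖f v‖ ^ 2 := by
    have := lp.norm_rpow_eq_tsum (p := 2) (by norm_num) f
    simpa using this
  have h2 : Summable fun v => ‖f v‖ ^ 2 := by
    have := (lp.memℓp f).summable (by norm_num)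
    simpa using this
  rw [h1, ENNReal.ofReal_tsum_of_nonneg (fun v => by positivity) h2]
  refine tsum_congr fun v => ?_
  rw [ENNReal.ofReal_pow (norm_nonneg _), ofReal_norm]

theorem memlp_shiftFun (h : IsBoundedWeights T lam) (j : Fin d) (f : L2 V) :
    Memℓp (shiftFun T lam j f) 2 := by
  obtain ⟨M, hM⟩ := h
  rw [memlp_two_iff]
  exact ne_top_of_le_ne_top
    (ENNReal.mul_ne_top ENNReal.coe_ne_top (memlp_two_iff.1 (lp.memℓp f)))
    (tsum_shiftFun_le hM j f)

variable (T lam) in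
/-- The `j`-th component `S_j` of the multishift with bounded weights, as a linear map. -/
noncomputable def multishiftLM (h : IsBoundedWeights T lam) (j : Fin d) : L2 V →ₗ[ℂ] L2 V where
  toFun f := ⟨shiftFun T lam j f, memlp_shiftFun h j f⟩
  map_add' f g := by
    ext v
    change shiftFun T lam j (⇑(f + g)) v = shiftFun T lam j f v + shiftFun T lam j g v
    by_cases hr : v j = (T j).root <;> simp [shiftFun, hr, mul_add]
  map_smul' a f := by
    ext v
    change shiftFun T lam j (⇑(a • f)) v = a * shiftFun T lam j f v
    by_cases hr : v j = (T j).root <;> simp [shiftFun, hr, mul_left_comm]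

theorem exists_bound_multishiftLM (h : IsBoundedWeights T lam) (j : Fin d) :
    ∃ C : ℝ, ∀ f, ‖multishiftLM T lam h j f‖ ≤ C * ‖f‖ := by
  obtain ⟨M, hM⟩ := id h
  refine ⟨Real.sqrt M, fun f => ?_⟩
  refine abs_le_of_sq_le_sq' ?_ (by positivity) |>.2
  have h1 : ENNReal.ofReal (‖multishiftLM T lam h j f‖ ^ 2) ≤ ENNReal.ofReal (M * ‖f‖ ^ 2) := by
    rw [ENNReal.ofReal_mul (by positivity), ofReal_norm_sq, ofReal_norm_sq,
      ENNReal.ofReal_coe_nnreal]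
    exact tsum_shiftFun_le hM j f
  rw [mul_pow, Real.sq_sqrt (by positivity)]
  exact (ENNReal.ofReal_le_ofReal_iff (by positivity)).1 h1

end bounded

/-- The `j`-th component `S_j` of the multishift `S_λ` with bounded weights, as a bounded operator
on `l²(V)`: `S_j f = Λ^{(j)} f`. -/
noncomputable def multishift (lam : Fin d → (∀ j, V j) → ℝ) (h : IsBoundedWeights T lam)
    (j : Fin d) : L2 V →L[ℂ] L2 V :=
  (multishiftLM T lam h j).mkContinuousOfExistsBound (exists_bound_multishiftLM h j)

/-- The joint kernel `E = ⋂_j ker S_j^*`. -/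
noncomputable def jointKernel (lam : Fin d → (∀ j, V j) → ℝ) (h : IsBoundedWeights T lam) :
    Submodule ℂ (L2 V) :=
  ⨅ j, (ContinuousLinearMap.adjoint (multishift T lam h j)).ker

instance completeSpace_jointKernel (lam : Fin d → (∀ j, V j) → ℝ) (h : IsBoundedWeights T lam) :
    CompleteSpace (jointKernel T lam h) := by
  have : IsClosed (jointKernel T lam h : Set (L2 V)) := by
    unfold jointKernel
    rw [Submodule.coe_iInf]
    exact isClosed_iInter fun j => ContinuousLinearMap.isClosed_ker _
  exact this.completeSpace_coe

/-- `𝓛_{u,F}`: the functions in `l²(sib_F(u))` which solve the system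
`∑_{w ∈ sib_j(v_G | u_j)} λ_j(w) f(w) = 0`, `j ∈ F`, `G = F \ {j}`, `v ∈ sib_F(u)`.
(If the trees are locally finite, the sums are finite.) -/
noncomputable def solSpace (lam : Fin d → (∀ j, V j) → ℝ) (F : Finset (Fin d)) (u : ∀ j, V j) :
    Submodule ℂ (L2 V) where
  carrier := {f | (∀ v, v ∉ sibF T F u → f v = 0) ∧
    ∀ j ∈ F, ∀ v ∈ sibF T F u,
      HasSum (fun w : sib T j (Function.update (restrict T (F.erase j) v) j (u j)) =>
        (lam j w : ℂ) * f w) 0}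
  zero_mem' := by
    refine ⟨fun v _ => rfl, fun j _ v _ => ?_⟩
    simp [hasSum_zero]
  add_mem' := by
    rintro f g ⟨hf, hf'⟩ ⟨hg, hg'⟩
    refine ⟨fun v hv => by simp [hf v hv, hg v hv], fun j hj v hv => ?_⟩
    simpa [mul_add] using (hf' j hj v hv).add (hg' j hj v hv)
  smul_mem' := by
    rintro a f ⟨hf, hf'⟩
    refine ⟨fun v hv => by simp [hf v hv], fun j hj v hv => ?_⟩
    simpa [mul_left_comm] using (hf' j hj v hv).mul_left a

theorem finite_sibF [∀ j, (T j).IsLocallyFinite] (F : Finset (Fin d)) (u : ∀ j, V j) :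
    (sibF T F u).Finite := by
  classical
  refine (Set.Finite.pi (t := fun j => if j ∈ F then (T j).sib (u j) else {u j})
    fun j => ?_).subset ?_
  · by_cases hj : j ∈ F
    · simpa [hj] using (T j).finite_sib (u j)
    · simp [hj]
  · rintro v ⟨h1, h2⟩ j -
    by_cases hj : j ∈ F
    · simpa [hj] using h1 j hj
    · simpa [hj] using h2 j hj

instance finiteDimensional_solSpace [∀ j, (T j).IsLocallyFinite]
    (lam : Fin d → (∀ j, V j) → ℝ) (F : Finset (Fin d)) (u : ∀ j, V j) :
    FiniteDimensional ℂ (solSpace T lam F u) := by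
  have : Finite (sibF T F u) := finite_sibF T F u
  let φ : solSpace T lam F u →ₗ[ℂ] (sibF T F u → ℂ) :=
    { toFun := fun f v => (f : L2 V) v
      map_add' := fun f g => rfl
      map_smul' := fun a f => rfl }
  refine FiniteDimensional.of_injective φ fun f g hfg => ?_
  ext v
  by_cases hv : v ∈ sibF T F u
  · exact congrFun hfg ⟨v, hv⟩
  · rw [f.2.1 v hv, g.2.1 v hv]

/-- `𝓛_{u,F}` as a subspace of the joint kernel `E`. -/
noncomputable def solSpaceIn (lam : Fin d → (∀ j, V j) → ℝ) (h : IsBoundedWeights T lam)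
    (F : Finset (Fin d)) (u : ∀ j, V j) : Submodule ℂ (jointKernel T lam h) :=
  (solSpace T lam F u).comap (jointKernel T lam h).subtype

instance finiteDimensional_solSpaceIn [∀ j, (T j).IsLocallyFinite]
    (lam : Fin d → (∀ j, V j) → ℝ) (h : IsBoundedWeights T lam) (F : Finset (Fin d))
    (u : ∀ j, V j) : FiniteDimensional ℂ (solSpaceIn T lam h F u) := by
  let φ : solSpaceIn T lam h F u →ₗ[ℂ] solSpace T lam F u :=
    { toFun := fun f => ⟨f.1.1, f.2⟩
      map_add' := fun f g => rfl
      map_smul' := fun a f => rfl }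
  refine FiniteDimensional.of_injective φ fun f g hfg => ?_
  exact Subtype.ext (Subtype.ext (congrArg (solSpace T lam F u).subtype hfg))

/-- The orthogonal projection `P_{𝓛_{u,F}} ∈ B(E)`. -/
noncomputable def projL [∀ j, (T j).IsLocallyFinite]
    (lam : Fin d → (∀ j, V j) → ℝ) (h : IsBoundedWeights T lam) (F : Finset (Fin d))
    (u : ∀ j, V j) : jointKernel T lam h →L[ℂ] jointKernel T lam h :=
  (solSpaceIn T lam h F u).starProjection

/-- The weight system `λ_c`: for `w ∈ Chi_j(v)`, so that `v = par_j(w)`,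
`λ_j(w) = √(c(|d_v|) / card Chi_j(v)) √((d_{v_j} + 1) / (|d_v| + d))`. -/
noncomputable def weights (c : ℕ → ℝ) (j : Fin d) (w : ∀ j, V j) : ℝ :=
  √(c (∑ i, depth T (par T j w) i) / (chi T j (par T j w)).ncard) *
    √((depth T (par T j w) j + 1) / ((∑ i, depth T (par T j w) i : ℕ) + d))

/-- If `c` is bounded above then the weights `λ_c` define bounded operators. -/
theorem isBoundedWeights_weights (c : ℕ → ℝ) (hc : BddAbove (Set.range c)) :
    IsBoundedWeights T (weights T c) := by
  obtain ⟨B, hB⟩ := hc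
  refine ⟨B.toNNReal, fun j v => ?_⟩
  have hpar : ∀ w ∈ chi T j v, par T j w = v := by
    rintro w ⟨h1, h2⟩
    funext i
    by_cases hi : i = j
    · subst hi
      simpa [par] using (T i).par_eq h1
    · simp [par, hi, h2 i hi]
  set n := ∑ i, depth T v i with hn
  have hle : ∀ w : chi T j v, ENNReal.ofReal (weights T c j w ^ 2) ≤
      ENNReal.ofReal (B.toNNReal / (chi T j v).ncard) := by
    intro w
    apply ENNReal.ofReal_le_ofReal
    unfold weights
    rw [hpar w w.2, mul_pow, Real.sq_sqrt (x := (_ + 1) / _) (by positivity)]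
    have hfrac : ((depth T v j : ℝ) + 1) / ((n : ℕ) + d) ≤ 1 := by
      have h1 : depth T v j ≤ n := Finset.single_le_sum (f := depth T v) (fun _ _ => Nat.zero_le _)
        (Finset.mem_univ j)
      have h2 : 1 ≤ d := Nat.succ_le_of_lt (Fin.pos j)
      apply div_le_one_of_le₀
      · have h3 : depth T v j + 1 ≤ n + d := by omega
        exact_mod_cast h3
      · positivity
    have hcB : √(c n / (chi T j v).ncard) ^ 2 ≤ B.toNNReal / (chi T j v).ncard := by
      have hmono : c n / (chi T j v).ncard ≤ B.toNNReal / (chi T j v).ncard := by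
        gcongr
        exact (hB ⟨n, rfl⟩).trans (Real.le_coe_toNNReal B)
      calc √(c n / (chi T j v).ncard) ^ 2 ≤ √(B.toNNReal / (chi T j v).ncard) ^ 2 := by
            gcongr
        _ = _ := Real.sq_sqrt (by positivity)
    calc _ ≤ √(c n / (chi T j v).ncard) ^ 2 * 1 := by gcongr
      _ ≤ _ := by rw [mul_one]; exact hcB
  refine (ENNReal.tsum_le_tsum hle).trans ?_
  by_cases hfin : (chi T j v).Finite
  · have := hfin.fintype
    rw [tsum_fintype, Finset.sum_const, Finset.card_univ, ← Nat.card_eq_fintype_card,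
      Nat.card_coe_set_eq, nsmul_eq_mul]
    by_cases h0 : (chi T j v).ncard = 0
    · simp [h0]
    · have : (0 : ℝ) < (chi T j v).ncard := by positivity
      rw [← ENNReal.ofReal_natCast, ← ENNReal.ofReal_mul (by positivity), mul_div_cancel₀ _ this.ne']
      simp
  · rw [Set.not_finite.1 hfin |>.ncard]
    simp

section family

variable (c : ℕ → ℝ) (hc : BddAbove (Set.range c))

/-- The components `S_1, …, S_d` of the multishift `S_{λ_c}`. -/
noncomputable abbrev multishiftOf (j : Fin d) : L2 V →L[ℂ] L2 V :=
  multishift T (weights T c) (isBoundedWeights_weights T c hc) j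

/-- The joint kernel `E` of `S_{λ_c}^*`. -/
noncomputable abbrev jointKernelOf : Submodule ℂ (L2 V) :=
  jointKernel T (weights T c) (isBoundedWeights_weights T c hc)

/-- The orthogonal projection of `E` onto `𝓛_{u,F}`. -/
noncomputable abbrev projOf [∀ j, (T j).IsLocallyFinite] (F : Finset (Fin d)) (u : ∀ j, V j) :
    jointKernelOf T c hc →L[ℂ] jointKernelOf T c hc :=
  projL T (weights T c) (isBoundedWeights_weights T c hc) F u

end family

/-- The scalar coefficient
`d_u! / (d_u + α)! ∏_{j < |α|} (|d_u| + d + j) / c(|d_u| + j)`, where `δ = d_u`. -/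
noncomputable def kernelCoeff (c : ℕ → ℝ) (δ α : Fin d → ℕ) : ℝ :=
  ((∏ i, (δ i).factorial : ℕ) : ℝ) / ((∏ i, (δ i + α i).factorial : ℕ) : ℝ) *
    ∏ j ∈ Finset.range (∑ i, α i), ((∑ i, δ i : ℕ) + d + j : ℝ) / c ((∑ i, δ i) + j)

/-- The term of index `α` of the scalar series, with `z^α \bar w^α`. -/
noncomputable def kernelTerm (c : ℕ → ℝ) (δ : Fin d → ℕ) (z w : EuclideanSpace ℂ (Fin d))
    (α : Fin d → ℕ) : ℂ :=
  (kernelCoeff c δ α : ℂ) * (∏ i, z i ^ α i) * ∏ i, (starRingEnd ℂ (w i)) ^ α i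

/-- The open ball `𝔹^d_r` of `ℂ^d`. -/
abbrev Ball (d : ℕ) (r : ℝ) : Set (EuclideanSpace ℂ (Fin d)) := Metric.ball 0 r

end TreeProduct

/-! The space `l²(V)` is the closed span of the pairwise orthogonal subspaces `S^α 𝓛_{u,F}`, and
`⟪S^α x, S^α y⟫ = a⁻¹ ⟪x, y⟫` for `x ∈ E`, `y ∈ 𝓛_{u,F}`, where `a` is the kernel coefficient of
index `α` at depth `d_u`. Sending `S^α y` to the monomial `z^α y` therefore turns vectors into
`E`-valued power series and `S_j` into multiplication by `z_j`. If `ev_z` is evaluation at `z`, the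
kernel is `ev_z ev_w^*`, which on `𝓛_{u,F}` is the scalar `∑ a z^α w̄^α`.

Orthogonality (`inner_multiPow`): the weights are constant on each `Chi_j(v)` and so normalised that
`S_j^* S_j` multiplies `f v` by a number depending only on the depth of `v`; moreover `ker S_j^*` is
invariant under `S_k` for `k ≠ j`. Moving the shifts one at a time across the inner product gives
the formula, the constants being governed by the recursion `inv_kernelCoeff_add_single`.

Totality (`eq_zero_of_inner_multiPow_eq_zero`): a vector orthogonal to all `S^α 𝓛_{u,F}` vanishes at
every vertex, by induction on `|d_v|`; the step applies the induction hypothesis to `S_j^* f`.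

Convergence: finite joint branching index leaves only finitely many nonzero `𝓛_{u,F}`
(`finite_setOf_solSpace_ne_bot`), and `inf c > 0` bounds each coefficient by `C R^|α|`
(`kernelCoeff_le`). Hence one ball serves all series.

The passage from orthogonality, totality and growth to the function space does not involve trees; it
is `AnalyticModel.IsWanderingSum.exists_rkhs`. -/

namespace MultiPowerSeries

/-! ### Power series in several complex variables. -/

theorem summable_pow_sum (d : ℕ) {ρ : ℝ} (h0 : 0 ≤ ρ) (h1 : ρ < 1) :
    Summable fun α : Fin d → ℕ => ρ ^ ∑ i, α i := by
  induction d with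
  | zero => exact (hasSum_fintype _).summable
  | succ d ih =>
    rw [← (Fin.consEquiv fun _ => ℕ).summable_iff]
    refine ((summable_geometric_of_lt_one h0 h1).mul_of_nonneg ih (fun _ => by positivity)
      (fun _ => by positivity)).congr fun x => ?_
    simp [Fin.consEquiv, Fin.sum_univ_succ, pow_add]

theorem norm_prod_pow_le {d : ℕ} {z : Fin d → ℂ} {r : ℝ} (hz : ∀ i, ‖z i‖ ≤ r) (α : Fin d → ℕ) :
    ‖∏ i, z i ^ α i‖ ≤ r ^ ∑ i, α i := by
  rw [norm_prod, ← Finset.prod_pow_eq_pow_sum]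
  refine Finset.prod_le_prod (fun _ _ => norm_nonneg _) fun i _ => ?_
  rw [norm_pow]
  exact pow_le_pow_left₀ (norm_nonneg _) (hz i) _

theorem eq_zero_of_hasSum_pow {F : Type*} [NormedAddCommGroup F] [NormedSpace ℂ F]
    {b : ℕ → F} {r : ℝ} (hr : 0 < r)
    (h : ∀ t : ℂ, ‖t‖ < r → HasSum (fun n => t ^ n • b n) 0) : b = 0 := by
  let p : FormalMultilinearSeries ℂ ℂ F := fun n => ContinuousMultilinearMap.mkPiRing ℂ (Fin n) (b n)
  have hp : ∀ n, p.coeff n = b n := fun n => by simp [p, FormalMultilinearSeries.coeff]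
  have h1 : HasFPowerSeriesAt (fun _ : ℂ => (0 : F)) p 0 := by
    rw [hasFPowerSeriesAt_iff]
    filter_upwards [Metric.ball_mem_nhds (0 : ℂ) hr] with t ht
    simpa [hp] using h t (by simpa using ht)
  have h2 := h1.eq_zero
  funext n
  rw [← hp, h2]
  rfl

/-- Uniqueness of the coefficients of a power series in several variables. -/
theorem eq_zero_of_hasSum {F : Type*} [NormedAddCommGroup F] [NormedSpace ℂ F] [CompleteSpace F]
    {r : ℝ} (hr : 0 < r) : ∀ {d : ℕ} {b : (Fin d → ℕ) → F},
    (∀ z : Fin d → ℂ, (∀ i, ‖z i‖ < r) → HasSum (fun α => (∏ i, z i ^ α i) • b α) 0) → b = 0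
  | 0, b, h => by
    have h1 := (h 0 (fun i => i.elim0)).unique (hasSum_fintype _)
    funext α
    simp only [Finset.univ_eq_empty, Finset.prod_empty, one_smul,
      Fintype.sum_unique] at h1
    exact (congrArg b (Subsingleton.elim _ _)).trans h1.symm
  -- Split off the first variable `t`. For fixed remaining variables, uniqueness in one variable
  -- kills the coefficient of each `t ^ n`, which is itself a power series in `d` variables.
  | d + 1, b, h => by
    have key : ∀ z : Fin d → ℂ, (∀ i, ‖z i‖ < r) → ∀ t : ℂ, ‖t‖ < r →
        HasSum (fun x : ℕ × (Fin d → ℕ) => t ^ x.1 • (∏ i, z i ^ x.2 i) • b (Fin.cons x.1 x.2)) 0 := by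
      intro z hz t ht
      have := (Fin.consEquiv fun _ => ℕ).hasSum_iff.2 (h (Fin.cons t z) (fun i => by
        refine Fin.cases ?_ (fun i => ?_) i <;> simp [ht, hz]))
      refine this.congr_fun fun x => ?_
      simp [Fin.consEquiv, Fin.prod_univ_succ, mul_smul]
    have key2 : ∀ z : Fin d → ℂ, (∀ i, ‖z i‖ < r) → ∀ n,
        Summable (fun α : Fin d → ℕ => (∏ i, z i ^ α i) • b (Fin.cons n α)) := by
      intro z hz n
      -- Any nonzero `t` in the disc would do: summability of the slice `n` is obtained by dividing
      -- by `t ^ n`.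
      have ht : ((r / 2 : ℝ) : ℂ) ≠ 0 := by exact_mod_cast (half_pos hr).ne'
      have h1 := (key z hz ((r / 2 : ℝ) : ℂ) (by
        rw [Complex.norm_real, Real.norm_of_nonneg (half_pos hr).le]; linarith)).summable.prod_factor n
      refine (h1.const_smul (((r / 2 : ℝ) : ℂ) ^ n)⁻¹).congr fun α => ?_
      exact inv_smul_smul₀ (pow_ne_zero n ht) _
    have key3 : ∀ n, (fun α : Fin d → ℕ => b (Fin.cons n α)) = 0 := by
      intro n
      refine eq_zero_of_hasSum hr fun z hz => ?_
      have h2 : (fun n => ∑' α : Fin d → ℕ, (∏ i, z i ^ α i) • b (Fin.cons n α)) = 0 :=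
        eq_zero_of_hasSum_pow hr fun t ht =>
          (key z hz t ht).prod_fiberwise fun n => ((key2 z hz n).hasSum.const_smul (t ^ n))
      have := (key2 z hz n).hasSum
      rwa [congrFun h2 n] at this
    funext α
    rw [← Fin.cons_self_tail α]
    exact congrFun (key3 _) _

/-- Cauchy's estimate for the Fréchet derivative. -/
theorem norm_fderiv_le {X F : Type*} [NormedAddCommGroup X] [NormedSpace ℂ X]
    [NormedAddCommGroup F] [NormedSpace ℂ F] {f : X → F} {x : X} {r M : ℝ} (hr : 0 < r)
    (hf : Differentiable ℂ f) (hM : ∀ y ∈ Metric.closedBall x r, ‖f y‖ ≤ M) :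
    ‖fderiv ℂ f x‖ ≤ M / r := by
  have hM0 : 0 ≤ M := (norm_nonneg _).trans (hM x (Metric.mem_closedBall_self hr.le))
  refine ContinuousLinearMap.opNorm_le_bound _ (by positivity) fun v => ?_
  rcases eq_or_ne v 0 with rfl | hv
  · simp
  have hv' : 0 < ‖v‖ := norm_pos_iff.2 hv
  have hd : HasDerivAt (fun t : ℂ => f (x + t • v)) (fderiv ℂ f x v) 0 := by
    have h1 : HasDerivAt (fun t : ℂ => x + t • v) v 0 := by
      simpa using ((hasDerivAt_id (0 : ℂ)).smul_const v).const_add x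
    have h2 : HasFDerivAt f (fderiv ℂ f x) (x + (0 : ℂ) • v) := by
      simpa using (hf x).hasFDerivAt
    exact h2.comp_hasDerivAt 0 h1
  have hdiff : Differentiable ℂ (fun t : ℂ => f (x + t • v)) := by fun_prop
  have := Complex.norm_deriv_le_of_forall_mem_sphere_norm_le (c := 0) (R := r / ‖v‖) (C := M)
    (by positivity) hdiff.diffContOnCl fun t ht => hM _ (by
      have ht' : ‖t‖ = r / ‖v‖ := by simpa using ht
      rw [Metric.mem_closedBall, dist_eq_norm, add_sub_cancel_left, norm_smul, ht',
        div_mul_cancel₀ _ hv'.ne'])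
  rw [hd.deriv] at this
  refine this.trans (le_of_eq ?_)
  field_simp

/-- Cauchy's estimate on balls of radius `r / 2`, which stay inside the ball of radius `2 * r`,
makes the derivatives summably bounded, so termwise differentiation applies. -/
theorem differentiableOn_tsum {ι X F : Type*} [NormedAddCommGroup X] [NormedSpace ℂ X]
    [NormedAddCommGroup F] [NormedSpace ℂ F] [CompleteSpace F] {f : ι → X → F} {u : ι → ℝ}
    {r : ℝ} (hr : 0 < r) (hu : Summable u) (hf : ∀ n, Differentiable ℂ (f n))
    (hM : ∀ n, ∀ y ∈ Metric.ball (0 : X) (2 * r), ‖f n y‖ ≤ u n) :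
    DifferentiableOn ℂ (fun x => ∑' n, f n x) (Metric.ball 0 r) := by
  intro x hx
  let _ : NormedSpace ℝ X := NormedSpace.restrictScalars ℝ ℂ X
  refine (hasFDerivAt_tsum_of_isPreconnected (hu.div_const (r / 2)) Metric.isOpen_ball
    (convex_ball (0 : X) r).isPreconnected (fun n y _ => (hf n y).hasFDerivAt) (fun n y hy => ?_)
    (Metric.mem_ball_self hr) ?_ hx).differentiableAt.differentiableWithinAt
  · refine norm_fderiv_le (half_pos hr) (hf n) fun w hw => hM n w ?_
    rw [mem_ball_zero_iff] at hy ⊢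
    rw [Metric.mem_closedBall, dist_eq_norm] at hw
    have := norm_add_le (w - y) y
    rw [sub_add_cancel] at this
    linarith
  · exact Summable.of_norm_bounded hu fun n => hM n 0 (Metric.mem_ball_self (by linarith))

end MultiPowerSeries

/-! ### Multiindices and powers of a commuting tuple. -/

theorem Pi.nat_induction_single {d : ℕ} {P : (Fin d → ℕ) → Prop} (zero : P 0)
    (add_single : ∀ β j, P β → P (β + Pi.single j 1)) (α : Fin d → ℕ) : P α := by
  obtain ⟨n, hn⟩ : ∃ n, n = ∑ i, α i := ⟨_, rfl⟩
  induction n generalizing α with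
  | zero =>
    have : α = 0 := by
      funext i
      exact Finset.sum_eq_zero_iff.1 hn.symm i (Finset.mem_univ i)
    rwa [this]
  | succ n ih =>
    obtain ⟨j, -, hj⟩ : ∃ j ∈ Finset.univ, α j ≠ 0 := by
      by_contra! h
      rw [Finset.sum_eq_zero h] at hn
      omega
    have hle : Pi.single j 1 ≤ α := by
      intro i
      rcases eq_or_ne i j with rfl | hi
      · simpa using Nat.one_le_iff_ne_zero.2 hj
      · simp [hi]
    have h : α = (α - Pi.single j 1) + Pi.single j 1 := (tsub_add_cancel_of_le hle).symm
    rw [h]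
    refine add_single _ _ (ih _ ?_)
    have := congrArg (fun β : Fin d → ℕ => ∑ i, β i) h
    simp only [Pi.add_apply, Finset.sum_add_distrib, Finset.sum_pi_single', Finset.mem_univ,
      if_true] at this
    omega

section multiPow

variable {M : Type*} [Monoid M] {d : ℕ} (S : Fin d → M) (hS : ∀ i j, Commute (S i) (S j))

/-- The power `S^α = S_1^{α_1} ⋯ S_d^{α_d}` of a commuting tuple. -/
noncomputable def multiPow (α : Fin d → ℕ) : M :=
  MonoidHom.noncommPiCoprod (fun i => powersHom M (S i))
    (fun i j _ x y => (hS i j).pow_pow x.toAdd y.toAdd) (fun i => Multiplicative.ofAdd (α i))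

theorem multiPow_zero : multiPow S hS 0 = 1 := map_one _

theorem multiPow_add (α β : Fin d → ℕ) :
    multiPow S hS (α + β) = multiPow S hS α * multiPow S hS β := map_mul _ _ _

theorem multiPow_single (j : Fin d) : multiPow S hS (Pi.single j 1) = S j := by
  have h : (fun i => Multiplicative.ofAdd ((Pi.single j 1 : Fin d → ℕ) i)) =
      Pi.mulSingle j (Multiplicative.ofAdd 1) := by
    funext i
    rcases eq_or_ne i j with rfl | hi
    · simp
    · simp [hi]
  unfold multiPow
  rw [h]
  exact (MonoidHom.noncommPiCoprod_mulSingle (fun i => powersHom M (S i)) j _).trans (pow_one _)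

theorem multiPow_add_single (α : Fin d → ℕ) (j : Fin d) :
    multiPow S hS (α + Pi.single j 1) = S j * multiPow S hS α := by
  rw [add_comm, multiPow_add, multiPow_single]

end multiPow

/-- Only `‖1‖ ≤ 1` is asked, so that operators on the zero space are covered. -/
theorem norm_multiPow_le {A : Type*} [NormedRing A] {d : ℕ} (S : Fin d → A)
    (hS : ∀ i j, Commute (S i) (S j)) {B : ℝ} (hB : ∀ i, ‖S i‖ ≤ B) (h1 : ‖(1 : A)‖ ≤ 1)
    (α : Fin d → ℕ) : ‖multiPow S hS α‖ ≤ B ^ ∑ i, α i := by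
  induction α using Pi.nat_induction_single with
  | zero => simpa [multiPow_zero] using h1
  | add_single β j ih =>
    rw [multiPow_add_single]
    simp only [Pi.add_apply, Finset.sum_add_distrib, Finset.sum_pi_single', Finset.mem_univ,
      if_true, pow_succ']
    exact (norm_mul_le _ _).trans
      (mul_le_mul (hB j) ih (norm_nonneg _) ((norm_nonneg _).trans (hB j)))

theorem HasSum.clm_apply {ι K E : Type*} [NormedAddCommGroup K] [NormedSpace ℂ K]
    [NormedAddCommGroup E] [NormedSpace ℂ E] {A : ι → K →L[ℂ] E} {B : K →L[ℂ] E} (h : HasSum A B)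
    (f : K) : HasSum (fun i => A i f) (B f) :=
  h.map (ContinuousLinearMap.apply ℂ E f) (ContinuousLinearMap.apply ℂ E f).continuous

/-! ### The function space attached to a commuting tuple with a wandering subspace. -/

namespace AnalyticModel

open scoped InnerProductSpace ComplexConjugate

variable {d : ℕ} {K : Type*} [NormedAddCommGroup K] [InnerProductSpace ℂ K] [CompleteSpace K]
  (S : Fin d → K →L[ℂ] K) (hS : ∀ i j, Commute (S i) (S j))
  {E : Type*} [NormedAddCommGroup E] [InnerProductSpace ℂ E] [CompleteSpace E] (J : E →L[ℂ] K)
  {ι : Type*} [Fintype ι] (L : ι → Submodule ℂ E) [∀ i, (L i).HasOrthogonalProjection]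
  (a : ι → (Fin d → ℕ) → ℝ)

/-- `J E` is a wandering subspace for the commuting tuple `S`, generating the whole space, and is the
orthogonal sum of the subspaces `L i`, on which the powers `S^α` are multiples of isometries with
constants `(a i α)⁻¹`. -/
structure IsWanderingSum : Prop where
  injective : Function.Injective J
  ne_zero : ∀ i α, a i α ≠ 0
  bound : ∃ C R : ℝ, 0 ≤ C ∧ 0 ≤ R ∧ ∀ i α, |a i α| ≤ C * R ^ ∑ j, α j
  orthogonal : ∀ i j, i ≠ j → ∀ x ∈ L i, ∀ y ∈ L j, ⟪x, y⟫_ℂ = 0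
  inner_pow : ∀ i, ∀ y ∈ L i, ∀ (x : E) (α β : Fin d → ℕ),
    ⟪multiPow S hS α (J x), multiPow S hS β (J y)⟫_ℂ =
      if α = β then ((a i α)⁻¹ : ℂ) * ⟪x, y⟫_ℂ else 0
  total : ∀ f : K, (∀ i, ∀ y ∈ L i, ∀ α, ⟪multiPow S hS α (J y), f⟫_ℂ = 0) → f = 0

/-- The operator `∑ i, a i α • S^α P_{L i}` from `E` to the whole space. -/
noncomputable def dualPow (α : Fin d → ℕ) : E →L[ℂ] K :=
  ∑ i, (a i α : ℂ) • (multiPow S hS α ∘L J ∘L (L i).starProjection)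

/-- The coefficient of index `α` of the power series representing a vector. -/
noncomputable def coeff (α : Fin d → ℕ) : K →L[ℂ] E :=
  ContinuousLinearMap.adjoint (dualPow S hS J L a α)

/-- The evaluation at `z` of the power series representing a vector. -/
noncomputable def evalAt (z : Fin d → ℂ) : K →L[ℂ] E :=
  ∑' α, (∏ i, z i ^ α i) • coeff S hS J L a α

variable {S hS J L a}

namespace IsWanderingSum

variable (h : IsWanderingSum S hS J L a)

include h

omit [CompleteSpace K] [CompleteSpace E] [Fintype ι] in
theorem starProjection_apply [DecidableEq ι] {i : ι} {y : E} (hy : y ∈ L i) (j : ι) :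
    (L j).starProjection y = if j = i then y else 0 := by
  split_ifs with hj
  · subst hj
    exact Submodule.starProjection_eq_self_iff.2 hy
  · rw [Submodule.starProjection_apply_eq_zero_iff, Submodule.mem_orthogonal]
    exact fun x hx => h.orthogonal j i hj x hx y hy

omit [CompleteSpace K] [CompleteSpace E] in
theorem dualPow_apply {i : ι} {y : E} (hy : y ∈ L i) (α : Fin d → ℕ) :
    dualPow S hS J L a α y = (a i α : ℂ) • multiPow S hS α (J y) := by
  classical
  simp only [dualPow, _root_.sum_apply, _root_.smul_apply,
    ContinuousLinearMap.comp_apply, h.starProjection_apply hy]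
  rw [Finset.sum_eq_single i]
  · simp
  · intro j _ hj
    simp [hj]
  · simp

omit [CompleteSpace K] [CompleteSpace E] [Fintype ι] [∀ i, (L i).HasOrthogonalProjection] in
-- The subspaces `L i` are total in `E` because their translates are total in `K`: if `x` is
-- orthogonal to all `L i`, then by `inner_pow`, with exponent `0` on `x`, `J x` is orthogonal to
-- every `S^α J y`.
theorem eq_zero_of_inner_eq_zero {x : E} (hx : ∀ i, ∀ y ∈ L i, ⟪y, x⟫_ℂ = 0) : x = 0 := by
  have hJ : J x = 0 := h.total _ fun i y hy α => by
    have h1 := h.inner_pow i y hy x 0 α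
    rw [multiPow_zero, ← inner_conj_symm x y, hx i y hy] at h1
    rw [← inner_conj_symm]
    simpa using congrArg conj h1
  refine h.injective ?_
  rw [hJ, map_zero]

omit [CompleteSpace K] [CompleteSpace E] in
theorem sum_starProjection (x : E) : ∑ i, (L i).starProjection x = x := by
  classical
  refine (sub_eq_zero.1 (h.eq_zero_of_inner_eq_zero fun i y hy => ?_)).symm
  rw [inner_sub_right, inner_sum, sub_eq_zero]
  simp_rw [← Submodule.inner_starProjection_left_eq_right, h.starProjection_apply hy]
  rw [Finset.sum_eq_single i]
  · simp
  · intro j _ hj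
    simp [hj]
  · simp

/-- The factor `a i α` in `dualPow` cancels the constant of `inner_pow`, so `dualPow` is
biorthogonal to the powers: `S^β J y` has the single coefficient `y`, at `β`. -/
theorem coeff_pow {i : ι} {y : E} (hy : y ∈ L i) (α β : Fin d → ℕ) :
    coeff S hS J L a α (multiPow S hS β (J y)) = if α = β then y else 0 := by
  classical
  have key : ∀ j, ∀ x ∈ L j, ⟪x, coeff S hS J L a α (multiPow S hS β (J y))⟫_ℂ =
      ⟪x, if α = β then y else 0⟫_ℂ := by
    intro j x hx
    rw [coeff, ContinuousLinearMap.adjoint_inner_right, h.dualPow_apply hx, inner_smul_left,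
      h.inner_pow i y hy x]
    split_ifs with hαβ
    · rcases eq_or_ne j i with rfl | hj
      · rw [Complex.conj_ofReal, mul_inv_cancel_left₀]
        exact_mod_cast h.ne_zero _ _
      · simp [h.orthogonal j i hj x hx y hy]
    · simp
  refine sub_eq_zero.1 (h.eq_zero_of_inner_eq_zero fun j x hx => ?_)
  rw [inner_sub_right, key j x hx, sub_self]

theorem eq_zero_of_coeff {f : K} (hf : ∀ α, coeff S hS J L a α f = 0) : f = 0 := by
  refine h.total f fun i y hy α => ?_
  have h1 : ⟪y, coeff S hS J L a α f⟫_ℂ = 0 := by rw [hf, inner_zero_right]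
  rw [coeff, ContinuousLinearMap.adjoint_inner_right, h.dualPow_apply hy, inner_smul_left] at h1
  exact (mul_eq_zero.1 h1).resolve_left (by simpa using h.ne_zero i α)

theorem exists_norm_coeff_le :
    ∃ C R : ℝ, 0 ≤ C ∧ 0 < R ∧ ∀ α, ‖coeff S hS J L a α‖ ≤ C * R ^ ∑ j, α j := by
  obtain ⟨C, R, hC, hR, hb⟩ := h.bound
  set B : ℝ := 1 + ∑ j, ‖S j‖ with hB
  have hBj : ∀ j, ‖S j‖ ≤ B := fun j => by
    have := Finset.single_le_sum (f := fun j => ‖S j‖) (fun _ _ => norm_nonneg _)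
      (Finset.mem_univ j)
    linarith
  have hB0 : 0 < B := by positivity
  -- `bound` only gives `0 ≤ R`; `R + 1` keeps the rate positive, as is needed to divide by it when
  -- the radius is chosen.
  refine ⟨Fintype.card ι * (C * ‖J‖), (R + 1) * B, by positivity, by positivity, fun α => ?_⟩
  rw [coeff, LinearIsometryEquiv.norm_map, dualPow]
  refine (norm_sum_le _ _).trans ((Finset.sum_le_card_nsmul _ _
    ((C * ‖J‖) * ((R + 1) * B) ^ ∑ j, α j) fun i _ => ?_).trans
    (by rw [nsmul_eq_mul, Finset.card_univ, ← mul_assoc]))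
  have h1 : ‖multiPow S hS α ∘L J ∘L (L i).starProjection‖ ≤
      B ^ (∑ j, α j) * ‖J‖ := by
    refine (ContinuousLinearMap.opNorm_comp_le _ _).trans ?_
    have h2 : ‖J ∘L (L i).starProjection‖ ≤ ‖J‖ :=
      (ContinuousLinearMap.opNorm_comp_le _ _).trans
        (mul_le_of_le_one_right (norm_nonneg _) (Submodule.starProjection_norm_le _))
    exact mul_le_mul (norm_multiPow_le S hS hBj ContinuousLinearMap.norm_id_le α) h2
      (norm_nonneg _) (by positivity)
  rw [norm_smul, Complex.norm_real, Real.norm_eq_abs, mul_pow]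
  have hR1 : R ^ ∑ j, α j ≤ (R + 1) ^ ∑ j, α j := by
    gcongr
    linarith
  calc _ ≤ (C * (R + 1) ^ ∑ j, α j) * (B ^ (∑ j, α j) * ‖J‖) :=
        mul_le_mul ((hb i α).trans (mul_le_mul_of_nonneg_left hR1 hC)) h1 (norm_nonneg _)
          (by positivity)
    _ = _ := by ring

/-- On a small ball the power series representing vectors converge geometrically. -/
theorem exists_radius : ∃ r₀ : ℝ, 0 < r₀ ∧ ∃ C : ℝ, 0 ≤ C ∧
    ∀ z : Fin d → ℂ, (∀ i, ‖z i‖ ≤ 2 * r₀) → ∀ α,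
      ‖(∏ i, z i ^ α i) • coeff S hS J L a α‖ ≤ C * (1 / 2) ^ ∑ j, α j := by
  obtain ⟨C, R, hC, hR, hb⟩ := h.exists_norm_coeff_le
  -- The radius for which `2 * r₀ * R = 1 / 2`; the factor `2` leaves room for Cauchy's estimate.
  refine ⟨1 / (4 * R), by positivity, C, hC, fun z hz α => ?_⟩
  rw [norm_smul]
  calc _ ≤ (2 * (1 / (4 * R))) ^ (∑ j, α j) * (C * R ^ ∑ j, α j) :=
        mul_le_mul (MultiPowerSeries.norm_prod_pow_le hz α) (hb α) (norm_nonneg _) (by positivity)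
    _ = C * ((2 * (1 / (4 * R))) * R) ^ ∑ j, α j := by rw [mul_pow _ R]; ring
    _ = _ := by congr 2; field_simp; norm_num

end IsWanderingSum

section convergent

variable {r C : ℝ} (hbd : ∀ z : Fin d → ℂ, (∀ i, ‖z i‖ ≤ 2 * r) → ∀ α,
  ‖(∏ i, z i ^ α i) • coeff S hS J L a α‖ ≤ C * (1 / 2) ^ ∑ j, α j)

include hbd

theorem hasSum_evalAt (hr : 0 < r) {z : Fin d → ℂ} (hz : ∀ i, ‖z i‖ ≤ r) :
    HasSum (fun α => (∏ i, z i ^ α i) • coeff S hS J L a α) (evalAt S hS J L a z) := by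
  refine (Summable.of_norm_bounded
    ((MultiPowerSeries.summable_pow_sum d (by norm_num) (by norm_num)).mul_left C)
    fun α => hbd z (fun i => ?_) α).hasSum
  linarith [hz i]

theorem hasSum_evalAt_apply (hr : 0 < r) {z : Fin d → ℂ} (hz : ∀ i, ‖z i‖ ≤ r) (f : K) :
    HasSum (fun α => (∏ i, z i ^ α i) • coeff S hS J L a α f) (evalAt S hS J L a z f) :=
  HasSum.clm_apply (hasSum_evalAt hbd hr hz) f

theorem evalAt_pow (h : IsWanderingSum S hS J L a) (hr : 0 < r) {z : Fin d → ℂ}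
    (hz : ∀ i, ‖z i‖ ≤ r) {i : ι} {y : E} (hy : y ∈ L i) (β : Fin d → ℕ) :
    evalAt S hS J L a z (multiPow S hS β (J y)) = (∏ i, z i ^ β i) • y := by
  classical
  refine (hasSum_evalAt_apply hbd hr hz _).unique ?_
  simp_rw [h.coeff_pow hy]
  have h1 := hasSum_single (f := fun α : Fin d → ℕ =>
    (∏ i, z i ^ α i) • if α = β then y else 0) β (fun α hα => by simp [hα])
  simpa only [if_true] using h1

/-- By `evalAt_pow` the adjoints of both sides have the same inner products with the total family
`S^α J y`, since `S_j` raises the exponent of `z_j` by one. -/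
theorem evalAt_shift (h : IsWanderingSum S hS J L a) (hr : 0 < r) {z : Fin d → ℂ}
    (hz : ∀ i, ‖z i‖ ≤ r) (j : Fin d) (f : K) :
    evalAt S hS J L a z (S j f) = z j • evalAt S hS J L a z f := by
  have key : evalAt S hS J L a z ∘L S j = z j • evalAt S hS J L a z := by
    apply ContinuousLinearMap.adjoint.injective
    ext1 x
    refine sub_eq_zero.1 (h.total _ fun i y hy α => ?_)
    rw [inner_sub_right, ContinuousLinearMap.adjoint_inner_right,
      ContinuousLinearMap.adjoint_inner_right, ContinuousLinearMap.comp_apply,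
      _root_.smul_apply, evalAt_pow hbd h hr hz hy,
      ← mul_apply_eq_comp, ← multiPow_add_single, evalAt_pow hbd h hr hz hy, smul_smul,
      sub_eq_zero]
    have h1 : ∏ i, z i ^ (Pi.single j 1 : Fin d → ℕ) i = z j := by
      simp [Pi.single_apply]
    simp only [Pi.add_apply, pow_add, Finset.prod_mul_distrib, h1, mul_comm]
  exact congrArg (fun A => A f) key

theorem eq_zero_of_evalAt (h : IsWanderingSum S hS J L a) (hr : 0 < r) {ρ : ℝ} (hρ : 0 < ρ)
    (hρr : ρ ≤ r) {f : K} (hf : ∀ z : Fin d → ℂ, (∀ i, ‖z i‖ < ρ) → evalAt S hS J L a z f = 0) :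
    f = 0 := by
  refine h.eq_zero_of_coeff fun α => ?_
  refine congrFun (MultiPowerSeries.eq_zero_of_hasSum (b := fun α => coeff S hS J L a α f) hρ
    fun z hz => ?_) α
  rw [← hf z hz]
  exact hasSum_evalAt_apply hbd hr (fun i => (hz i).le.trans hρr) f

/-- Termwise, the adjoint of evaluation at `w` sends `y` to `∑ a w̄^α S^α J y`, and evaluation at
`z` turns `S^α J y` into `z^α y`. This is the kernel on `L i`. -/
theorem evalAt_adjoint (h : IsWanderingSum S hS J L a) (hr : 0 < r) {z w : Fin d → ℂ}
    (hz : ∀ i, ‖z i‖ ≤ r) (hw : ∀ i, ‖w i‖ ≤ r) {i : ι} {y : E} (hy : y ∈ L i) :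
    evalAt S hS J L a z (ContinuousLinearMap.adjoint (evalAt S hS J L a w) y) =
      (∑' α, (a i α : ℂ) * (∏ i, z i ^ α i) * ∏ i, (conj (w i)) ^ α i) • y := by
  have h1 : HasSum (fun α => ContinuousLinearMap.adjoint ((∏ i, w i ^ α i) • coeff S hS J L a α))
      (ContinuousLinearMap.adjoint (evalAt S hS J L a w)) :=
    (hasSum_evalAt hbd hr hw).map (ContinuousLinearMap.adjoint (𝕜 := ℂ) (E := K) (F := E))
      (LinearIsometryEquiv.continuous _)
  have h2 := (evalAt S hS J L a z).hasSum (h1.clm_apply y)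
  have h3 : ∀ α, evalAt S hS J L a z
      (ContinuousLinearMap.adjoint ((∏ i, w i ^ α i) • coeff S hS J L a α) y) =
      ((a i α : ℂ) * (∏ i, z i ^ α i) * ∏ i, (conj (w i)) ^ α i) • y := by
    intro α
    rw [map_smulₛₗ, coeff, ContinuousLinearMap.adjoint_adjoint,
      _root_.smul_apply, h.dualPow_apply hy, map_smul, map_smul,
      evalAt_pow hbd h hr hz hy, smul_smul, smul_smul]
    congr 1
    simp only [map_prod, map_pow]
    ring
  simp_rw [h3] at h2
  rcases eq_or_ne y 0 with rfl | hy0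
  · simp
  -- The series is known to converge only after multiplication by `y`; pairing with `y ≠ 0` gives
  -- convergence of the scalar series.
  · have h4 := (h2.map (innerSL ℂ y) (innerSL ℂ y).continuous).summable
    simp only [Function.comp_def, innerSL_apply_apply, inner_smul_right] at h4
    have h5 := (summable_mul_right_iff (inner_self_ne_zero.2 hy0)).1 h4
    exact h2.unique (h5.hasSum.smul_const y)

theorem differentiableOn_evalAt {ρ : ℝ} (hρ : 0 < ρ) (hρr : ρ ≤ r) (f : K) :
    DifferentiableOn ℂ (fun z : EuclideanSpace ℂ (Fin d) => evalAt S hS J L a z f)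
      (Metric.ball 0 ρ) := by
  have hu : Summable fun α : Fin d → ℕ => C * (1 / 2 : ℝ) ^ (∑ j, α j) * ‖f‖ :=
    ((MultiPowerSeries.summable_pow_sum d (by norm_num) (by norm_num)).mul_left C).mul_right _
  have hd : ∀ α : Fin d → ℕ, Differentiable ℂ
      fun z : EuclideanSpace ℂ (Fin d) => (∏ i, z i ^ α i) • coeff S hS J L a α f :=
    fun α => by fun_prop
  have h1 := MultiPowerSeries.differentiableOn_tsum hρ hu hd fun α z hz => by
    have hz' : ∀ i, ‖z i‖ ≤ 2 * r := fun i => by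
      have := (PiLp.norm_apply_le z i).trans (mem_ball_zero_iff.1 hz).le
      linarith
    have h2 := ContinuousLinearMap.le_of_opNorm_le _ (hbd z hz' α) f
    rwa [_root_.smul_apply] at h2
  refine h1.congr fun z hz => ?_
  refine (hasSum_evalAt_apply hbd (hρ.trans_le hρr) (fun i => ?_) f).tsum_eq.symm
  exact ((PiLp.norm_apply_le z i).trans (mem_ball_zero_iff.1 hz).le).trans hρr

end convergent

/-- The analytic model of a commuting tuple possessing a wandering sum. -/
theorem IsWanderingSum.exists_rkhs (h : IsWanderingSum S hS J L a) :
    ∃ r₀ : ℝ, 0 < r₀ ∧ ∀ r, 0 < r → r ≤ r₀ →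
      ∃ _ : RKHS ℂ K (Metric.ball (0 : EuclideanSpace ℂ (Fin d)) r) E,
        (∀ f : K, ∃ g : EuclideanSpace ℂ (Fin d) → E,
          DifferentiableOn ℂ g (Metric.ball 0 r) ∧
            ∀ z : Metric.ball (0 : EuclideanSpace ℂ (Fin d)) r, f z = g z) ∧
        (∀ (j : Fin d) (f : K) (z : Metric.ball (0 : EuclideanSpace ℂ (Fin d)) r),
          S j f z = (z : EuclideanSpace ℂ (Fin d)) j • f z) ∧
        ∀ z w : Metric.ball (0 : EuclideanSpace ℂ (Fin d)) r, RKHS.kernel K z w =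
          ∑ i, (∑' α, (a i α : ℂ) * (∏ i, (z : EuclideanSpace ℂ (Fin d)) i ^ α i) *
            ∏ i, (conj ((w : EuclideanSpace ℂ (Fin d)) i)) ^ α i) • (L i).starProjection := by
  obtain ⟨r₀, hr₀, C, hC, hbd⟩ := h.exists_radius
  refine ⟨r₀, hr₀, fun r hr hrr => ?_⟩
  have hball : ∀ z : Metric.ball (0 : EuclideanSpace ℂ (Fin d)) r, ∀ i,
      ‖(z : EuclideanSpace ℂ (Fin d)) i‖ ≤ r₀ := fun z i =>
    ((PiLp.norm_apply_le _ i).trans (mem_ball_zero_iff.1 z.2).le).trans hrr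
  let ev : K →L[ℂ] (Metric.ball (0 : EuclideanSpace ℂ (Fin d)) r → E) :=
    ContinuousLinearMap.pi fun z => evalAt S hS J L a (z : EuclideanSpace ℂ (Fin d))
  -- The Hilbert space is `K` itself, its vectors being regarded as functions through `evalAt`; no
  -- new space is built.
  let R : RKHS ℂ K (Metric.ball (0 : EuclideanSpace ℂ (Fin d)) r) E :=
    { coeCLM := ev
      coeCLM_injective := by
        refine (injective_iff_map_eq_zero ev).2 fun f hf => ?_
        -- Uniqueness of coefficients is stated on polydiscs, so a polydisc inside the Euclidean
        -- ball is needed.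
        have hcont : Continuous (fun z : Fin d → ℂ => (WithLp.toLp 2 z : EuclideanSpace ℂ (Fin d))) :=
          PiLp.continuous_toLp 2 _
        obtain ⟨ρ, hρ, hρb⟩ := Metric.continuous_iff.1 hcont 0 r hr
        refine eq_zero_of_evalAt hbd h hr₀ (lt_min hρ hr₀) (min_le_right _ _) fun z hz => ?_
        have hz' : dist z 0 < ρ := by
          rw [dist_zero_right, pi_norm_lt_iff hρ]
          exact fun i => (hz i).trans_le (min_le_left _ _)
        exact congrFun hf ⟨WithLp.toLp 2 z, hρb z hz'⟩ }
  have hcoe : ∀ (f : K) (z : Metric.ball (0 : EuclideanSpace ℂ (Fin d)) r),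
      f z = evalAt S hS J L a (z : EuclideanSpace ℂ (Fin d)) f := fun f z => rfl
  refine ⟨R, fun f => ⟨fun z => evalAt S hS J L a z f, ?_, fun z => rfl⟩, fun j f z => ?_,
    fun z w => ?_⟩
  · exact differentiableOn_evalAt hbd hr hrr f
  · rw [hcoe, hcoe]
    exact evalAt_shift hbd h hr₀ (hball z) j f
  · ext1 x
    have hk : RKHS.kernel K z w x = evalAt S hS J L a (z : EuclideanSpace ℂ (Fin d))
        (ContinuousLinearMap.adjoint
          (evalAt S hS J L a (w : EuclideanSpace ℂ (Fin d))) x) :=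
      (RKHS.kerFun_apply K w x z).symm
    rw [hk]
    conv_lhs => rw [← h.sum_starProjection x]
    simp only [map_sum, _root_.sum_apply, _root_.smul_apply]
    exact Finset.sum_congr rfl fun i _ =>
      evalAt_adjoint hbd h hr₀ (hball z) (hball w) (Submodule.starProjection_apply_mem _ _)

end AnalyticModel

/-! ### Depths and siblings in a single tree. -/

namespace RootedDirectedTree

variable {V : Type u} (T : RootedDirectedTree V)

theorem mem_iterate_depth (v : V) : v ∈ T.chiSet^[T.depth v] {T.root} :=
  (T.existsUnique_depth v).choose_spec.1

theorem depth_eq {v : V} {n : ℕ} (h : v ∈ T.chiSet^[n] {T.root}) : T.depth v = n :=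
  (T.existsUnique_depth v).unique (T.mem_iterate_depth v) h

theorem depth_of_adj {v w : V} (h : T.Adj v w) : T.depth w = T.depth v + 1 := by
  apply T.depth_eq
  rw [Function.iterate_succ_apply']
  exact ⟨v, T.mem_iterate_depth v, h⟩

theorem ne_root_of_adj {v w : V} (h : T.Adj v w) : w ≠ T.root :=
  fun e => T.root_no_parent v (e ▸ h)

theorem mem_sib_iff {v w : V} (hv : v ≠ T.root) : w ∈ T.sib v ↔ T.Adj (T.par v) w := by
  constructor
  · rintro ⟨p, hp, hw⟩
    rwa [T.par_eq hp]
  · exact fun h => ⟨_, T.adj_par hv, h⟩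

theorem par_of_mem_sib {v w : V} (h : w ∈ T.sib v) : T.par w = T.par v := by
  obtain ⟨p, hp, hw⟩ := h
  rw [T.par_eq hp, T.par_eq hw]

theorem ne_root_of_mem_sib {v w : V} (h : w ∈ T.sib v) : w ≠ T.root := by
  obtain ⟨p, -, hw⟩ := h
  exact T.ne_root_of_adj hw

theorem mem_sib_comm {v w : V} : w ∈ T.sib v ↔ v ∈ T.sib w :=
  ⟨fun ⟨p, h1, h2⟩ => ⟨p, h2, h1⟩, fun ⟨p, h1, h2⟩ => ⟨p, h2, h1⟩⟩

theorem depth_of_mem_sib {v w : V} (h : w ∈ T.sib v) : T.depth w = T.depth v := by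
  obtain ⟨p, hp, hw⟩ := h
  rw [T.depth_of_adj hp, T.depth_of_adj hw]

theorem finite_setOf_depth_eq [T.IsLocallyFinite] (n : ℕ) : {v | T.depth v = n}.Finite := by
  have h : ∀ n, (T.chiSet^[n] {T.root}).Finite := by
    intro n
    induction n with
    | zero => exact Set.finite_singleton _
    | succ n ih =>
      rw [Function.iterate_succ_apply']
      refine (ih.biUnion fun v _ => IsLocallyFinite.finite_chi (T := T) v).subset ?_
      rintro w ⟨v, hv, hw⟩
      exact Set.mem_biUnion hv hw
  exact (h n).subset fun v hv => by
    have := T.mem_iterate_depth v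
    rwa [show T.depth v = n from hv] at this

theorem finite_setOf_depth_le [T.IsLocallyFinite] (n : ℕ) : {v | T.depth v ≤ n}.Finite := by
  refine ((Set.finite_Iic n).biUnion fun k _ => T.finite_setOf_depth_eq k).subset fun v hv => ?_
  exact Set.mem_biUnion (x := T.depth v) hv rfl

theorem exists_depth_le_of_branchingIndex (h : T.branchingIndex < ⊤) :
    ∃ b : ℕ, ∀ v ∈ T.branching, T.depth v ≤ b := by
  by_cases hne : T.branching.Nonempty
  · rw [branchingIndex, if_pos hne] at h
    have h1 : (⨆ w ∈ T.branching, (T.depth w : ℕ∞)) ≠ ⊤ := by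
      intro e
      rw [e] at h
      simp at h
    refine ⟨(⨆ w ∈ T.branching, (T.depth w : ℕ∞)).toNat, fun v hv => ?_⟩
    rw [← ENat.natCast_le_natCast, ENat.natCast_toNat h1]
    exact le_iSup₂ (f := fun w (_ : w ∈ T.branching) => (T.depth w : ℕ∞)) v hv
  · exact ⟨0, fun v hv => absurd ⟨v, hv⟩ hne⟩

end RootedDirectedTree

/-! ### The product of trees, its weights, and the operators `S_j` with their adjoints. -/

namespace TreeProduct

variable {d : ℕ} {V : Fin d → Type u} (T : ∀ j, RootedDirectedTree (V j))

section vertices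

variable {T}

theorem mem_chi_iff {j : Fin d} {v w : ∀ j, V j} :
    w ∈ chi T j v ↔ w j ≠ (T j).root ∧ par T j w = v := by
  constructor
  · rintro ⟨h1, h2⟩
    refine ⟨(T j).ne_root_of_adj h1, ?_⟩
    funext i
    by_cases hi : i = j
    · subst hi
      simpa [par] using (T i).par_eq h1
    · simp [par, hi, h2 i hi]
  · rintro ⟨h1, rfl⟩
    refine ⟨?_, fun i hi => by simp [par, hi]⟩
    simpa [par, RootedDirectedTree.chi] using (T j).adj_par h1

theorem depth_of_mem_chi {j : Fin d} {v w : ∀ j, V j} (h : w ∈ chi T j v) :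
    depth T w = depth T v + Pi.single j 1 := by
  funext i
  by_cases hi : i = j
  · subst hi
    simpa [depth] using (T i).depth_of_adj h.1
  · simp [depth, hi, h.2 i hi]

theorem chi_eq_image (j : Fin d) (v : ∀ j, V j) :
    chi T j v = Function.update v j '' (T j).chi (v j) := by
  ext w
  constructor
  · rintro ⟨h1, h2⟩
    refine ⟨w j, h1, ?_⟩
    funext i
    by_cases hi : i = j
    · subst hi
      simp
    · simp [hi, h2 i hi]
  · rintro ⟨x, hx, rfl⟩
    exact ⟨by simpa using hx, fun i hi => by simp [hi]⟩

theorem ncard_chi (j : Fin d) (v : ∀ j, V j) : (chi T j v).ncard = ((T j).chi (v j)).ncard := by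
  rw [chi_eq_image, Set.ncard_image_of_injective _ (Function.update_injective v j)]

theorem finite_chi [∀ j, (T j).IsLocallyFinite] (j : Fin d) (v : ∀ j, V j) :
    (chi T j v).Finite := by
  rw [chi_eq_image]
  exact (RootedDirectedTree.IsLocallyFinite.finite_chi (T := T j) (v j)).image _

theorem ncard_chi_pos (hl : ∀ j, (T j).IsLeafless) [∀ j, (T j).IsLocallyFinite] (j : Fin d)
    (v : ∀ j, V j) : 0 < (chi T j v).ncard := by
  rw [ncard_chi, Set.ncard_pos (RootedDirectedTree.IsLocallyFinite.finite_chi (T := T j) (v j))]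
  exact hl j (v j)

theorem par_comm {j k : Fin d} (hjk : j ≠ k) (v : ∀ j, V j) :
    par T j (par T k v) = par T k (par T j v) := by
  simp only [par, Function.update_of_ne hjk, Function.update_of_ne hjk.symm]
  exact Function.update_comm hjk.symm _ _ _

theorem par_apply_of_ne {j k : Fin d} (hjk : k ≠ j) (v : ∀ j, V j) : par T j v k = v k := by
  simp [par, hjk]

theorem mem_chi_par {j : Fin d} {v : ∀ j, V j} (h : v j ≠ (T j).root) :
    v ∈ chi T j (par T j v) := mem_chi_iff.2 ⟨h, rfl⟩

end vertices

section weights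

variable (c : ℕ → ℝ)

/-- The common value of the weights `λ_j(w)`, `w ∈ Chi_j(v)`. -/
noncomputable def outWeight (j : Fin d) (v : ∀ j, V j) : ℝ :=
  √(c (∑ i, depth T v i) / (chi T j v).ncard) *
    √((depth T v j + 1) / ((∑ i, depth T v i : ℕ) + d))

/-- The eigenvalue of `S_j^* S_j` on the functions supported on the vertices of depth `δ`. -/
noncomputable def growth (j : Fin d) (δ : Fin d → ℕ) : ℝ :=
  c (∑ i, δ i) * ((δ j + 1) / ((∑ i, δ i : ℕ) + d))

variable {T c}

theorem weights_of_mem_chi {j : Fin d} {v w : ∀ j, V j} (h : w ∈ chi T j v) :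
    weights T c j w = outWeight T c j v := by
  rw [weights, (mem_chi_iff.1 h).2, outWeight]

theorem outWeight_congr {j : Fin d} {v w : ∀ j, V j} (hd : depth T v = depth T w)
    (hj : v j = w j) : outWeight T c j v = outWeight T c j w := by
  rw [outWeight, outWeight, hd, ncard_chi, ncard_chi, hj]

theorem outWeight_pos (hl : ∀ j, (T j).IsLeafless) [∀ j, (T j).IsLocallyFinite]
    (hc : ∀ t, 0 < c t) (j : Fin d) (v : ∀ j, V j) : 0 < outWeight T c j v := by
  have h1 := ncard_chi_pos hl j v
  have h2 := hc (∑ i, depth T v i)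
  have h3 := Fin.pos j
  unfold outWeight
  positivity

/-- The cardinality in the weight is cancelled by the number of children, so the sum of squared
weights over `Chi_j(v)` depends on `v` only through its depth. -/
theorem outWeight_sq (hc : ∀ t, 0 < c t) (hl : ∀ j, (T j).IsLeafless)
    [∀ j, (T j).IsLocallyFinite] (j : Fin d) (v : ∀ j, V j) :
    (chi T j v).ncard * outWeight T c j v ^ 2 = growth c j (depth T v) := by
  have h1 := ncard_chi_pos hl j v
  have h2 := hc (∑ i, depth T v i)
  rw [outWeight, mul_pow, Real.sq_sqrt (by positivity), Real.sq_sqrt (by positivity), growth,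
    ← mul_assoc, mul_div_cancel₀ _ (by positivity)]

/-- Both two-step paths contain the same factors: the values of `c` and the denominators depend only
on total depth, which goes up by one either way, while the cardinality and depth of one coordinate
are unaffected by a step in the other. This is what makes the shifts commute. -/
theorem outWeight_mul_comm (hc : ∀ t, 0 < c t) {j k : Fin d} (hjk : j ≠ k) {v x y : ∀ j, V j}
    (hx : x ∈ chi T k v) (hy : y ∈ chi T j v) :
    outWeight T c j x * outWeight T c k v = outWeight T c k y * outWeight T c j v := by
  have hxj : x j = v j := hx.2 j hjk
  have hyk : y k = v k := hy.2 k hjk.symm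
  have hsum : ∀ i : Fin d, ∑ l, (depth T v + Pi.single i 1 : Fin d → ℕ) l = ∑ l, depth T v l + 1 := by
    intro i
    simp [Finset.sum_add_distrib]
  have e1 : (depth T v + Pi.single k 1 : Fin d → ℕ) j = depth T v j := by simp [hjk]
  have e2 : (depth T v + Pi.single j 1 : Fin d → ℕ) k = depth T v k := by simp [hjk.symm]
  unfold outWeight
  rw [depth_of_mem_chi hx, depth_of_mem_chi hy, hsum, hsum, e1, e2, ncard_chi j x, ncard_chi k y,
    hxj, hyk, ncard_chi, ncard_chi]
  have := fun t => (hc t).le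
  rw [Real.sqrt_div (this _), Real.sqrt_div (this _), Real.sqrt_div (this _),
    Real.sqrt_div (this _), Real.sqrt_div (by positivity), Real.sqrt_div (by positivity),
    Real.sqrt_div (by positivity), Real.sqrt_div (by positivity)]
  ring

end weights

section operators

variable {T} {c : ℕ → ℝ} {hcs : BddAbove (Set.range c)}

theorem multishiftOf_apply (j : Fin d) (f : L2 V) (v : ∀ j, V j) :
    multishiftOf T c hcs j f v = shiftFun T (weights T c) j f v := rfl

theorem multishiftOf_apply_of_root {j : Fin d} (f : L2 V) {v : ∀ j, V j}
    (hv : v j = (T j).root) : multishiftOf T c hcs j f v = 0 := by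
  rw [multishiftOf_apply, shiftFun, if_pos hv]

theorem multishiftOf_apply_of_mem_chi {j : Fin d} (f : L2 V) {v w : ∀ j, V j}
    (h : w ∈ chi T j v) : multishiftOf T c hcs j f w = outWeight T c j v * f v := by
  rw [multishiftOf_apply, shiftFun, if_neg (mem_chi_iff.1 h).1, weights_of_mem_chi h,
    (mem_chi_iff.1 h).2]

theorem multishiftOf_apply_of_ne_root {j : Fin d} (f : L2 V) {v : ∀ j, V j}
    (hv : v j ≠ (T j).root) :
    multishiftOf T c hcs j f v = outWeight T c j (par T j v) * f (par T j v) :=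
  multishiftOf_apply_of_mem_chi f (mem_chi_par hv)

theorem commute_multishiftOf (hc : ∀ t, 0 < c t) (j k : Fin d) :
    Commute (multishiftOf T c hcs j) (multishiftOf T c hcs k) := by
  rcases eq_or_ne j k with rfl | hjk
  · exact Commute.refl _
  ext f v
  rw [mul_apply_eq_comp, mul_apply_eq_comp]
  by_cases hj : v j = (T j).root
  · rw [multishiftOf_apply_of_root _ hj]
    by_cases hk : v k = (T k).root
    · rw [multishiftOf_apply_of_root _ hk]
    · rw [multishiftOf_apply_of_ne_root _ hk, multishiftOf_apply_of_root _ (by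
        rwa [par_apply_of_ne hjk]), mul_zero]
  · have hj' : par T k v j ≠ (T j).root := by rwa [par_apply_of_ne hjk]
    rw [multishiftOf_apply_of_ne_root _ hj]
    by_cases hk : v k = (T k).root
    · rw [multishiftOf_apply_of_root _ hk, multishiftOf_apply_of_root _ (by
        rwa [par_apply_of_ne hjk.symm]), mul_zero]
    · have hk' : par T j v k ≠ (T k).root := by rwa [par_apply_of_ne hjk.symm]
      rw [multishiftOf_apply_of_ne_root _ hk, multishiftOf_apply_of_ne_root _ hk',
        multishiftOf_apply_of_ne_root _ hj', par_comm hjk, ← mul_assoc, ← mul_assoc]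
      congr 1
      have := outWeight_mul_comm hc hjk (mem_chi_par hk')
        (par_comm hjk v ▸ mem_chi_par hj' : par T k v ∈ chi T j (par T k (par T j v)))
      exact_mod_cast this

variable [∀ j, (T j).IsLocallyFinite]

open scoped InnerProductSpace

/-- Pair `f` with the image of the point mass at `v`, which is a constant multiple of the indicator
of `Chi_j(v)`. -/
theorem adjoint_multishiftOf_apply (j : Fin d) (f : L2 V) (v : ∀ j, V j) :
    ContinuousLinearMap.adjoint (multishiftOf T c hcs j) f v =
      outWeight T c j v * ∑ w ∈ (finite_chi (T := T) j v).toFinset, f w := by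
  classical
  have h1 : multishiftOf T c hcs j (lp.single 2 v 1) =
      ∑ w ∈ (finite_chi (T := T) j v).toFinset, lp.single 2 w (outWeight T c j v : ℂ) := by
    ext w
    simp only [lp.coeFn_sum, Finset.sum_apply, lp.single_apply, Finset.sum_pi_single,
      Set.Finite.mem_toFinset]
    split_ifs with hw
    · rw [multishiftOf_apply_of_mem_chi _ hw]
      simp
    · by_cases hr : w j = (T j).root
      · exact multishiftOf_apply_of_root _ hr
      · rw [multishiftOf_apply_of_ne_root _ hr, lp.single_apply, Pi.single_eq_of_ne, mul_zero]
        exact fun e => hw (mem_chi_iff.2 ⟨hr, e⟩)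
  have h2 := ContinuousLinearMap.adjoint_inner_right (multishiftOf T c hcs j) (lp.single 2 v 1) f
  rw [h1, lp.inner_single_left, sum_inner] at h2
  simp only [lp.inner_single_left, RCLike.inner_apply, map_one, mul_one, Complex.conj_ofReal] at h2
  rw [h2, ← Finset.sum_mul, mul_comm]

variable (hl : ∀ j, (T j).IsLeafless) (hc : ∀ t, 0 < c t)

include hl hc in
theorem adjoint_multishiftOf_apply_eq_zero_iff (j : Fin d) (f : L2 V) (v : ∀ j, V j) :
    ContinuousLinearMap.adjoint (multishiftOf T c hcs j) f v = 0 ↔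
      ∑ w ∈ (finite_chi (T := T) j v).toFinset, f w = 0 := by
  rw [adjoint_multishiftOf_apply, mul_eq_zero, or_iff_right]
  exact Complex.ofReal_ne_zero.2 (outWeight_pos hl hc j v).ne'

include hl hc in
theorem mem_jointKernelOf_iff (f : L2 V) : f ∈ jointKernelOf T c hcs ↔
    ∀ j v, ∑ w ∈ (finite_chi (T := T) j v).toFinset, f w = 0 := by
  simp only [jointKernelOf, jointKernel, Submodule.mem_iInf, LinearMap.mem_ker]
  refine forall_congr' fun j => ?_
  simp_rw [← adjoint_multishiftOf_apply_eq_zero_iff (hcs := hcs) hl hc]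
  constructor
  · intro h v
    exact congrArg (fun g : L2 V => g v) h
  · intro h
    ext v
    exact h v

include hl hc in
theorem adjoint_multishiftOf_multishiftOf_self (j : Fin d) (f : L2 V) (v : ∀ j, V j) :
    ContinuousLinearMap.adjoint (multishiftOf T c hcs j) (multishiftOf T c hcs j f) v =
      growth c j (depth T v) * f v := by
  have h : ∑ w ∈ (finite_chi (T := T) j v).toFinset, multishiftOf T c hcs j f w =
      ∑ w ∈ (finite_chi (T := T) j v).toFinset, (outWeight T c j v : ℂ) * f v :=
    Finset.sum_congr rfl fun w hw =>
      multishiftOf_apply_of_mem_chi f ((Set.Finite.mem_toFinset _).1 hw)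
  rw [adjoint_multishiftOf_apply, h, Finset.sum_const, ← Set.ncard_eq_toFinset_card _ (finite_chi j v), ← outWeight_sq hc hl]
  push_cast
  ring

include hl hc in
/-- The weights being constant on `Chi_j(v)`, the kernel of `S_j^*` is invariant under `S_k` for
`k ≠ j`. -/
theorem adjoint_multishiftOf_multishiftOf_eq_zero {j k : Fin d} (hjk : j ≠ k) {f : L2 V}
    (hf : ContinuousLinearMap.adjoint (multishiftOf T c hcs j) f = 0) :
    ContinuousLinearMap.adjoint (multishiftOf T c hcs j) (multishiftOf T c hcs k f) = 0 := by
  ext v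
  refine (adjoint_multishiftOf_apply_eq_zero_iff hl hc j _ v).2 ?_
  by_cases hk : v k = (T k).root
  · refine Finset.sum_eq_zero fun w hw => multishiftOf_apply_of_root _ ?_
    rw [((Set.Finite.mem_toFinset _).1 hw).2 k hjk.symm, hk]
  · have hmem : ∀ w ∈ chi T j v, par T k w ∈ chi T j (par T k v) := by
      intro w hw
      obtain ⟨h1, h2⟩ := mem_chi_iff.1 hw
      exact mem_chi_iff.2 ⟨by rwa [par_apply_of_ne hjk], by rw [par_comm hjk, h2]⟩
    have h1 : ∀ w ∈ chi T j v, ∀ w' ∈ chi T j v,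
        outWeight T c k (par T k w) = outWeight T c k (par T k w') := by
      intro w hw w' hw'
      refine outWeight_congr ?_ ?_
      · rw [depth_of_mem_chi (hmem w hw), depth_of_mem_chi (hmem w' hw')]
      · rw [(hmem w hw).2 k hjk.symm, (hmem w' hw').2 k hjk.symm]
    obtain ⟨x, hx⟩ : (chi T j v).Nonempty := by
      rw [← Set.ncard_pos (finite_chi j v)]
      exact ncard_chi_pos hl j v
    have h2 : ∀ w ∈ (finite_chi (T := T) j v).toFinset, multishiftOf T c hcs k f w =
        outWeight T c k (par T k x) * f (par T k w) := by
      intro w hw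
      rw [Set.Finite.mem_toFinset] at hw
      rw [multishiftOf_apply_of_ne_root _ (by rwa [hw.2 k hjk.symm]), h1 w hw x hx]
    rw [Finset.sum_congr rfl h2, ← Finset.mul_sum]
    have h3 := (adjoint_multishiftOf_apply_eq_zero_iff (hcs := hcs) hl hc j f (par T k v)).1
      (congrArg (fun g : L2 V => g (par T k v)) hf)
    -- `par_k` maps `Chi_j(v)` bijectively onto `Chi_j(par_k v)`, the inverse restoring the
    -- coordinate `v k`; so the sum is the one that vanishes for `f`.
    refine mul_eq_zero_of_right _ (Eq.trans (Finset.sum_bij (fun w _ => par T k w)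
      (fun w hw => ?_) (fun w hw w' hw' e => ?_) (fun w' hw' => ?_) fun _ _ => rfl) h3)
    · simpa using hmem w (by simpa using hw)
    · rw [Set.Finite.mem_toFinset] at hw hw'
      funext i
      by_cases hi : i = k
      · subst hi
        rw [hw.2 i hjk.symm, hw'.2 i hjk.symm]
      · have := congrFun e i
        rwa [par_apply_of_ne hi, par_apply_of_ne hi] at this
    · rw [Set.Finite.mem_toFinset] at hw'
      have hpar : par T k (Function.update w' k (v k)) = w' := by
        have := hw'.2 k hjk.symm
        funext i
        by_cases hi : i = k
        · subst hi
          rw [this]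
          simp [par]
        · simp [par, hi]
      refine ⟨Function.update w' k (v k), ?_, hpar⟩
      rw [Set.Finite.mem_toFinset]
      refine ⟨?_, fun i hi => ?_⟩
      · have := hw'.1
        rw [par_apply_of_ne hjk] at this
        simpa [hjk] using this
      · by_cases hi' : i = k
        · subst hi'
          simp
        · rw [Function.update_of_ne hi', hw'.2 i hi, par_apply_of_ne hi']

end operators

end TreeProduct

/-! ### The kernel coefficients and the orthogonality of the powers. -/

namespace TreeProduct

variable {d : ℕ} {V : Fin d → Type u} {T : ∀ j, RootedDirectedTree (V j)}

open scoped InnerProductSpace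

section coefficients

variable {c : ℕ → ℝ}

theorem sum_add_single (β : Fin d → ℕ) (j : Fin d) :
    ∑ i, (β + Pi.single j 1 : Fin d → ℕ) i = ∑ i, β i + 1 := by
  simp [Finset.sum_add_distrib]

theorem kernelCoeff_zero (δ : Fin d → ℕ) : kernelCoeff c δ 0 = 1 := by
  have : ((∏ i, (δ i).factorial : ℕ) : ℝ) ≠ 0 :=
    Nat.cast_ne_zero.2 (Finset.prod_ne_zero_iff.2 fun i _ => Nat.factorial_ne_zero _)
  simp only [kernelCoeff, Pi.zero_apply, add_zero, Finset.sum_const_zero, Finset.range_zero,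
    Finset.prod_empty, mul_one]
  exact div_self this

theorem kernelCoeff_pos (hd : 0 < d) (hc : ∀ t, 0 < c t) (δ α : Fin d → ℕ) :
    0 < kernelCoeff c δ α := by
  refine mul_pos (div_pos ?_ ?_) (Finset.prod_pos fun j _ => div_pos ?_ (hc _))
  · exact Nat.cast_pos.2 (Finset.prod_pos fun i _ => Nat.factorial_pos _)
  · exact Nat.cast_pos.2 (Finset.prod_pos fun i _ => Nat.factorial_pos _)
  · positivity

theorem growth_pos (hc : ∀ t, 0 < c t) (j : Fin d) (δ : Fin d → ℕ) : 0 < growth c j δ := by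
  have h1 := hc (∑ i, δ i)
  have h2 := Fin.pos j
  unfold growth
  positivity

/-- Explains the shape of the coefficient: its reciprocal is the product of the eigenvalues of
`S_j^* S_j` met on the way from depth `δ` to depth `δ + α`. -/
theorem inv_kernelCoeff_add_single (hc : ∀ t, 0 < c t) (δ α : Fin d → ℕ) (j : Fin d) :
    (kernelCoeff c δ (α + Pi.single j 1))⁻¹ = growth c j (δ + α) * (kernelCoeff c δ α)⁻¹ := by
  have hd := Fin.pos j
  have h1 := kernelCoeff_pos hd hc δ α
  have h2 := growth_pos hc j (δ + α)
  have h3 := hc (∑ i, (δ + α) i)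
  have h4 : (∏ i, (δ i + (α + Pi.single j 1 : Fin d → ℕ) i).factorial) =
      (δ j + α j + 1) * ∏ i, (δ i + α i).factorial := by
    rw [← Finset.mul_prod_erase _ _ (Finset.mem_univ j),
      ← Finset.mul_prod_erase _ (fun i => (δ i + α i).factorial) (Finset.mem_univ j), ← mul_assoc]
    congr 1
    · simp [← add_assoc, Nat.factorial_succ]
    · refine Finset.prod_congr rfl fun i hi => ?_
      simp [Finset.ne_of_mem_erase hi]
  have h5 : kernelCoeff c δ (α + Pi.single j 1) * growth c j (δ + α) = kernelCoeff c δ α := by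
    have h6 : ((∏ i, (δ i + α i).factorial : ℕ) : ℝ) ≠ 0 :=
      Nat.cast_ne_zero.2 (Finset.prod_ne_zero_iff.2 fun i _ => Nat.factorial_ne_zero _)
    have h7 : ((∑ i, δ i : ℕ) + d + (∑ i, α i : ℕ) : ℝ) ≠ 0 := by positivity
    have h8 : (δ j + α j + 1 : ℝ) ≠ 0 := by positivity
    simp only [Pi.add_apply, Finset.sum_add_distrib] at h3
    rw [kernelCoeff, sum_add_single, Finset.prod_range_succ, h4, kernelCoeff, growth]
    simp only [Pi.add_apply, Finset.sum_add_distrib]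
    rw [Nat.cast_mul]
    push_cast at h6 h7 ⊢
    have h9 : (∑ i, (δ i : ℝ)) + (∑ i, (α i : ℝ)) + d ≠ 0 := by
      rwa [add_right_comm]
    field_simp
    ring
  rw [← h5, mul_inv, mul_left_comm, mul_inv_cancel₀ h2.ne', mul_one]

end coefficients

section orthogonality

variable {c : ℕ → ℝ} {hcs : BddAbove (Set.range c)} [∀ j, (T j).IsLocallyFinite]
  (hl : ∀ j, (T j).IsLeafless) (hc : ∀ t, 0 < c t)
  (hS : ∀ i j, Commute (multishiftOf T c hcs i) (multishiftOf T c hcs j))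

omit [∀ j, (T j).IsLocallyFinite] in
theorem depth_of_multiPow_ne_zero {f : L2 V} {δ : Fin d → ℕ}
    (hf : ∀ v, f v ≠ 0 → depth T v = δ) (α : Fin d → ℕ) :
    ∀ v, multiPow (multishiftOf T c hcs) hS α f v ≠ 0 → depth T v = δ + α := by
  induction α using Pi.nat_induction_single with
  | zero => simpa [multiPow_zero] using hf
  | add_single β j ih =>
    intro v hv
    rw [multiPow_add_single, mul_apply_eq_comp] at hv
    have hr : v j ≠ (T j).root := fun e => hv (multishiftOf_apply_of_root _ e)
    rw [multishiftOf_apply_of_ne_root _ hr] at hv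
    rw [depth_of_mem_chi (mem_chi_par hr), ih _ (right_ne_zero_of_mul hv), add_assoc]

include hl hc in
theorem adjoint_multishiftOf_multiPow_eq_zero {j : Fin d} {f : L2 V}
    (hf : ContinuousLinearMap.adjoint (multishiftOf T c hcs j) f = 0) (α : Fin d → ℕ)
    (hα : α j = 0) :
    ContinuousLinearMap.adjoint (multishiftOf T c hcs j)
      (multiPow (multishiftOf T c hcs) hS α f) = 0 := by
  induction α using Pi.nat_induction_single with
  | zero => simpa [multiPow_zero] using hf
  | add_single β k ih =>
    have hjk : j ≠ k := by
      rintro rfl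
      simp at hα
    rw [multiPow_add_single, mul_apply_eq_comp]
    exact adjoint_multishiftOf_multishiftOf_eq_zero hl hc hjk (ih (by simpa [hjk] using hα))

include hl hc in
-- Induction on `α`, moving one `S_j` to the right. If `β j = 0`, then `S_j^*` kills `S^β y`;
-- otherwise `S_j^* S_j` acts as a scalar, because `S^γ y` lives at the single depth `δ + γ`. Only
-- `y` needs a single depth.
theorem inner_multiPow {x y : L2 V} {δ : Fin d → ℕ} (hx : x ∈ jointKernelOf T c hcs)
    (hy : y ∈ jointKernelOf T c hcs) (hyδ : ∀ v, y v ≠ 0 → depth T v = δ) (α β : Fin d → ℕ) :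
    ⟪multiPow (multishiftOf T c hcs) hS α x, multiPow (multishiftOf T c hcs) hS β y⟫_ℂ =
      if α = β then ((kernelCoeff c δ α)⁻¹ : ℂ) * ⟪x, y⟫_ℂ else 0 := by
  have hker : ∀ {f : L2 V}, f ∈ jointKernelOf T c hcs →
      ∀ j, ContinuousLinearMap.adjoint (multishiftOf T c hcs j) f = 0 := by
    intro f hf j
    exact (Submodule.mem_iInf _).1 hf j
  induction α using Pi.nat_induction_single generalizing β with
  | zero =>
    induction β using Pi.nat_induction_single with
    | zero => simp [multiPow_zero, kernelCoeff_zero]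
    | add_single β j =>
      have h : (0 : Fin d → ℕ) ≠ β + Pi.single j 1 := fun e => by simpa using congrFun e j
      rw [if_neg h, multiPow_add_single, mul_apply_eq_comp, multiPow_zero,
        one_apply_eq_self, ← ContinuousLinearMap.adjoint_inner_left, hker hx,
        inner_zero_left]
  | add_single α j ih =>
    rw [multiPow_add_single, mul_apply_eq_comp, ← ContinuousLinearMap.adjoint_inner_right]
    by_cases hβ : β j = 0
    · have h : α + Pi.single j 1 ≠ β := fun e => by simp [← e] at hβ
      rw [if_neg h, adjoint_multishiftOf_multiPow_eq_zero hl hc hS (hker hy j) β hβ,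
        inner_zero_right]
    · obtain ⟨γ, rfl⟩ : ∃ γ : Fin d → ℕ, β = γ + Pi.single j 1 := by
        refine ⟨β - Pi.single j 1, (tsub_add_cancel_of_le fun i => ?_).symm⟩
        rcases eq_or_ne i j with rfl | hi
        · simpa using Nat.one_le_iff_ne_zero.2 hβ
        · simp [hi]
      have h : ContinuousLinearMap.adjoint (multishiftOf T c hcs j)
          (multiPow (multishiftOf T c hcs) hS (γ + Pi.single j 1) y) =
          (growth c j (δ + γ) : ℂ) • multiPow (multishiftOf T c hcs) hS γ y := by
        ext v
        rw [multiPow_add_single, mul_apply_eq_comp,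
          adjoint_multishiftOf_multishiftOf_self hl hc, lp.coeFn_smul, Pi.smul_apply, smul_eq_mul]
        by_cases hv : multiPow (multishiftOf T c hcs) hS γ y v = 0
        · rw [hv, mul_zero, mul_zero]
        · rw [depth_of_multiPow_ne_zero hS hyδ γ v hv]
      rw [h, inner_smul_right, ih]
      simp only [add_left_inj]
      split_ifs with hαγ
      · subst hαγ
        rw [← mul_assoc]
        congr 1
        have := inv_kernelCoeff_add_single hc δ α j
        exact_mod_cast this.symm
      · rw [mul_zero]

end orthogonality

end TreeProduct

/-! ### The sibling classes and the spaces `𝓛_{u,F}`. -/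

namespace TreeProduct

variable {d : ℕ} {V : Fin d → Type u} {T : ∀ j, RootedDirectedTree (V j)}

open scoped InnerProductSpace

section classes

variable {F F' : Finset (Fin d)} {u u' v w : ∀ j, V j}

theorem mem_sibF_comm : w ∈ sibF T F v ↔ v ∈ sibF T F w :=
  ⟨fun h => ⟨fun j hj => (T j).mem_sib_comm.1 (h.1 j hj), fun j hj => (h.2 j hj).symm⟩,
    fun h => ⟨fun j hj => (T j).mem_sib_comm.1 (h.1 j hj), fun j hj => (h.2 j hj).symm⟩⟩

theorem mem_Phi_of_mem_sibF (hu : u ∈ Phi T F) (hw : w ∈ sibF T F u) : w ∈ Phi T F := by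
  intro j
  by_cases hj : j ∈ F
  · simp [hj, (T j).ne_root_of_mem_sib (hw.1 j hj)]
  · rw [hw.2 j hj]
    exact hu j

theorem depth_of_mem_sibF (hw : w ∈ sibF T F u) : depth T w = depth T u := by
  funext j
  by_cases hj : j ∈ F
  · exact (T j).depth_of_mem_sib (hw.1 j hj)
  · simp [depth, hw.2 j hj]

theorem eq_of_mem_Phi (h : v ∈ Phi T F) (h' : v ∈ Phi T F') : F = F' := by
  ext j
  exact (h j).trans (h' j).symm

/-- The set `sib_j(v_G | u_j)` is a set of children. -/
theorem sib_update_restrict (hu : u ∈ Phi T F) {j : Fin d} (hj : j ∈ F) (hv : v ∈ sibF T F u) :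
    sib T j (Function.update (restrict T (F.erase j) v) j (u j)) = chi T j (par T j v) := by
  have huj := (hu j).1 hj
  have key : ∀ i, i ≠ j → restrict T (F.erase j) v i = v i := by
    intro i hi
    by_cases hiF : i ∈ F
    · simp [restrict, hi, hiF]
    · have : v i = (T i).root := by
        rw [hv.2 i hiF]
        exact not_not.1 fun h => hiF ((hu i).2 h)
      simp [restrict, hiF, this]
  ext w
  simp only [sib, chi, Set.mem_ofPred_eq, Function.update_self]
  refine and_congr ?_ (forall₂_congr fun i hi => ?_)
  · rw [(T j).mem_sib_iff huj, ← (T j).par_of_mem_sib (hv.1 j hj)]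
    simp [par, RootedDirectedTree.chi]
  · rw [Function.update_of_ne hi, key i hi, par_apply_of_ne hi]

variable {Ω : Finset (Fin d) → Set (∀ j, V j)} (hΩ : ∀ F, IsIndexingSet T F (Ω F))

include hΩ

theorem exists_mem_sibF (v : ∀ j, V j) : ∃ F, ∃ u ∈ Ω F, v ∈ sibF T F u := by
  classical
  let F : Finset (Fin d) := Finset.univ.filter fun j => v j ≠ (T j).root
  have hv : v ∈ Phi T F := fun j => by simp [F]
  obtain ⟨u, ⟨hu, huv⟩, -⟩ := (hΩ F).2 v hv
  exact ⟨F, u, hu, mem_sibF_comm.1 huv⟩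

theorem eq_of_mem_sibF (hu : u ∈ Ω F) (hu' : u' ∈ Ω F') (hv : v ∈ sibF T F u)
    (hv' : v ∈ sibF T F' u') : F = F' ∧ u = u' := by
  have h := mem_Phi_of_mem_sibF ((hΩ F).1 hu) hv
  obtain rfl := eq_of_mem_Phi h (mem_Phi_of_mem_sibF ((hΩ F').1 hu') hv')
  exact ⟨rfl, ((hΩ F).2 v h).unique ⟨hu, mem_sibF_comm.1 hv⟩ ⟨hu', mem_sibF_comm.1 hv'⟩⟩

end classes

section solutions

variable {c : ℕ → ℝ} {hcs : BddAbove (Set.range c)} [∀ j, (T j).IsLocallyFinite]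
  (hl : ∀ j, (T j).IsLeafless) (hc : ∀ t, 0 < c t)
  {F : Finset (Fin d)} {u : ∀ j, V j}

include hl hc

/-- As the weights are constant on the sets of children, they can be dropped from the system
defining `𝓛_{u,F}`. -/
theorem mem_solSpace_iff (hu : u ∈ Phi T F) (f : L2 V) :
    f ∈ solSpace T (weights T c) F u ↔ (∀ v, v ∉ sibF T F u → f v = 0) ∧
      ∀ j ∈ F, ∀ v ∈ sibF T F u,
        ∑ w ∈ (finite_chi (T := T) j (par T j v)).toFinset, f w = 0 := by
  refine and_congr_right fun _ => forall₂_congr fun j hj => forall₂_congr fun v hv => ?_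
  rw [sib_update_restrict hu hj hv]
  have hfin := finite_chi (T := T) j (par T j v)
  have h1 : HasSum (fun w : chi T j (par T j v) => (weights T c j w : ℂ) * f w)
      (outWeight T c j (par T j v) * ∑ w ∈ hfin.toFinset, f w) := by
    have h2 := hfin.toFinset.hasSum (fun w => (weights T c j w : ℂ) * f w)
    rw [Finset.sum_congr rfl fun w hw => by
      rw [weights_of_mem_chi ((Set.Finite.mem_toFinset _).1 hw)], ← Finset.mul_sum] at h2
    -- Generalising the index set allows replacing the coerced finset by `Chi_j` without rewriting
    -- inside a subtype.
    have h4 : ∀ s : Set (∀ j, V j), (hfin.toFinset : Set (∀ j, V j)) = s →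
        HasSum (fun w : s => (weights T c j w : ℂ) * f w)
          (outWeight T c j (par T j v) * ∑ w ∈ hfin.toFinset, f w) := by
      rintro _ rfl
      exact h2
    exact h4 _ hfin.coe_toFinset
  have h3 : (outWeight T c j (par T j v) : ℂ) ≠ 0 :=
    Complex.ofReal_ne_zero.2 (outWeight_pos hl hc j _).ne'
  constructor
  · exact fun h => (mul_eq_zero.1 (h1.unique h)).resolve_left h3
  · intro h
    rwa [h, mul_zero] at h1

/-- If `Chi_j(v)` meets `sib_F(u)`, the condition for `ker S_j^*` at `v` is one of the defining
equations; otherwise `f` vanishes on `Chi_j(v)`. -/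
theorem solSpace_le_jointKernelOf (hu : u ∈ Phi T F) :
    solSpace T (weights T c) F u ≤ jointKernelOf T c hcs := by
  intro f hf
  obtain ⟨h1, h2⟩ := (mem_solSpace_iff hl hc hu f).1 hf
  refine (mem_jointKernelOf_iff hl hc f).2 fun j v => ?_
  by_cases h : ∃ w ∈ chi T j v, w ∈ sibF T F u
  · obtain ⟨w, hw, hwu⟩ := h
    obtain ⟨hr, rfl⟩ := mem_chi_iff.1 hw
    exact h2 j ((mem_Phi_of_mem_sibF hu hwu j).2 hr) w hwu
  · push Not at h
    exact Finset.sum_eq_zero fun w hw => h1 w (h w ((Set.Finite.mem_toFinset _).1 hw))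

omit hl hc in
open Classical in
theorem sum_single_apply (f : L2 V) (s : Finset (∀ j, V j)) (v : ∀ j, V j) :
    (∑ w ∈ s, lp.single 2 w (f w) : L2 V) v = if v ∈ s then f v else 0 := by
  simp only [lp.coeFn_sum, Finset.sum_apply, lp.single_apply, Finset.sum_pi_single]

open Classical in
-- Cutting `f` off to `sib_F(u)` preserves the equations, because for `j ∈ F` the class contains
-- `Chi_j(par_j v)` along with `v`.
theorem sum_single_mem_solSpace (hu : u ∈ Phi T F) (f : L2 V)
    (hf : ∀ j ∈ F, ∀ v ∈ sibF T F u,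
      ∑ w ∈ (finite_chi (T := T) j (par T j v)).toFinset, f w = 0) :
    (∑ w ∈ (finite_sibF T F u).toFinset, lp.single 2 w (f w) : L2 V) ∈
      solSpace T (weights T c) F u := by
  refine (mem_solSpace_iff hl hc hu _).2 ⟨fun v hv => ?_, fun j hj v hv => ?_⟩
  · rw [sum_single_apply, if_neg (by simpa using hv)]
  · rw [← hf j hj v hv]
    refine Finset.sum_congr rfl fun w hw => ?_
    rw [sum_single_apply, if_pos]
    rw [Set.Finite.mem_toFinset] at hw ⊢
    refine ⟨fun i hi => ?_, fun i hi => ?_⟩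
    · rw [(T i).mem_sib_iff ((hu i).1 hi), ← (T i).par_of_mem_sib (hv.1 i hi)]
      by_cases hij : i = j
      · subst hij
        simpa [par, RootedDirectedTree.chi] using hw.1
      · rw [hw.2 i hij, par_apply_of_ne hij]
        exact (T i).adj_par ((mem_Phi_of_mem_sibF hu hv i).1 hi)
    · have hij : i ≠ j := fun e => hi (e ▸ hj)
      rw [hw.2 i hij, par_apply_of_ne hij, hv.2 i hi]

omit hl hc in
open Classical in
theorem apply_eq_zero_of_inner_sum_single (f : L2 V) (s : Finset (∀ j, V j))
    (h : ⟪(∑ w ∈ s, lp.single 2 w (f w) : L2 V), f⟫_ℂ = 0) {v : ∀ j, V j} (hv : v ∈ s) :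
    f v = 0 := by
  simp only [sum_inner, lp.inner_single_left, RCLike.inner_apply, RCLike.mul_conj] at h
  have h' : ∑ w ∈ s, ‖f w‖ ^ 2 = 0 := by
    rw [← Complex.ofReal_eq_zero, ← h]
    push_cast
    rfl
  have := (Finset.sum_eq_zero_iff_of_nonneg fun w _ => by positivity).1 h' v hv
  simpa using this

/-- The subspaces `S^α 𝓛_{u,F}` span `l²(V)`. -/
theorem eq_zero_of_inner_multiPow_eq_zero
    (hS : ∀ i j, Commute (multishiftOf T c hcs i) (multishiftOf T c hcs j))
    {Ω : Finset (Fin d) → Set (∀ j, V j)} (hΩ : ∀ F, IsIndexingSet T F (Ω F)) (f : L2 V)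
    (hf : ∀ F, ∀ u ∈ Ω F, ∀ y ∈ solSpace T (weights T c) F u, ∀ α,
      ⟪multiPow (multishiftOf T c hcs) hS α y, f⟫_ℂ = 0) : f = 0 := by
  classical
  -- The vector is quantified inside the induction, which passes from `f` to `S_j^* f`.
  have key : ∀ (n : ℕ) (f : L2 V), (∀ F, ∀ u ∈ Ω F, ∀ y ∈ solSpace T (weights T c) F u, ∀ α,
      ⟪multiPow (multishiftOf T c hcs) hS α y, f⟫_ℂ = 0) →
      ∀ v, ∑ i, depth T v i = n → f v = 0 := by
    intro n
    induction n with
    | zero =>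
      intro f hf v hv
      obtain ⟨F, u, hu, hvu⟩ := exists_mem_sibF hΩ v
      -- At total depth `0` all coordinates are roots, so there are no equations to satisfy.
      have hF : ∀ j, j ∉ F := by
        intro j hj
        have h1 := (T j).adj_par ((mem_Phi_of_mem_sibF ((hΩ F).1 hu) hvu j).1 hj)
        have h2 := (T j).depth_of_adj h1
        have h3 := Finset.sum_eq_zero_iff.1 hv j (Finset.mem_univ j)
        rw [depth] at h3
        omega
      have h := hf F u hu _ (sum_single_mem_solSpace hl hc ((hΩ F).1 hu) f
        fun j hj => absurd hj (hF j)) 0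
      rw [multiPow_zero] at h
      exact apply_eq_zero_of_inner_sum_single f _ h (by simpa using hvu)
    | succ n ih =>
      intro f hf v hv
      obtain ⟨F, u, hu, hvu⟩ := exists_mem_sibF hΩ v
      have h := hf F u hu _ (sum_single_mem_solSpace hl hc ((hΩ F).1 hu) f
        fun j hj w hw => ?_) 0
      · rw [multiPow_zero] at h
        exact apply_eq_zero_of_inner_sum_single f _ h (by simpa using hvu)
      -- The equation at `w` says that `S_j^* f` vanishes at `par_j w`, of total depth `n`; and
      -- `S_j^* f` is again orthogonal to all `S^α 𝓛_{u,F}`. So the cut-off of `f` lies in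
      -- `𝓛_{u,F}`, hence is orthogonal to `f`, hence zero.
      · rw [← adjoint_multishiftOf_apply_eq_zero_iff (hcs := hcs) hl hc]
        refine ih _ (fun F u hu y hy α => ?_) _ ?_
        · rw [ContinuousLinearMap.adjoint_inner_right, ← mul_apply_eq_comp, ← multiPow_add_single]
          exact hf F u hu y hy _
        · have h1 := depth_of_mem_chi (mem_chi_par
            ((mem_Phi_of_mem_sibF ((hΩ F).1 hu) hw j).1 hj))
          rw [← depth_of_mem_sibF hw |>.trans (depth_of_mem_sibF hvu).symm, h1,
            sum_add_single] at hv
          omega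
  ext v
  exact key _ f hf v rfl

omit [∀ j, (T j).IsLocallyFinite] hl hc in
theorem inner_eq_zero_of_mem_solSpace {F' : Finset (Fin d)} {u' : ∀ j, V j}
    {Ω : Finset (Fin d) → Set (∀ j, V j)} (hΩ : ∀ F, IsIndexingSet T F (Ω F))
    (hu : u ∈ Ω F) (hu' : u' ∈ Ω F') (hne : ¬ (F = F' ∧ u = u')) {x y : L2 V}
    (hx : x ∈ solSpace T (weights T c) F u) (hy : y ∈ solSpace T (weights T c) F' u') :
    ⟪x, y⟫_ℂ = 0 := by
  have h := lp.hasSum_inner (𝕜 := ℂ) x y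
  refine h.unique ?_
  convert hasSum_zero using 2 with v
  by_cases hv : v ∈ sibF T F u
  · rw [hy.1 v fun hv' => hne (eq_of_mem_sibF hΩ hu hu' hv hv'), inner_zero_right]
  · rw [hx.1 v hv, inner_zero_left]

/-- A nonzero space `𝓛_{u,F}` requires `u_j` to have at least two siblings for `j ∈ F`. -/
theorem mem_branching_of_solSpace_ne_bot (hu : u ∈ Phi T F)
    (h : solSpace T (weights T c) F u ≠ ⊥) {j : Fin d} (hj : j ∈ F) :
    (T j).par (u j) ∈ (T j).branching := by
  by_contra hb
  refine h ((Submodule.eq_bot_iff _).2 fun f hf => ?_)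
  obtain ⟨h1, h2⟩ := (mem_solSpace_iff hl hc hu f).1 hf
  ext v
  by_cases hv : v ∈ sibF T F u
  · have h3 := h2 j hj v hv
    have hmem : v ∈ chi T j (par T j v) := mem_chi_par ((mem_Phi_of_mem_sibF hu hv j).1 hj)
    have hsub : (chi T j (par T j v)).Subsingleton := by
      rw [chi_eq_image]
      refine Set.Subsingleton.image ?_ _
      rw [← Set.encard_le_one_iff_subsingleton]
      have h4 : ¬ 2 ≤ ((T j).chi ((T j).par (u j))).encard := hb
      have h5 : par T j v j = (T j).par (u j) := by
        simp [par, (T j).par_of_mem_sib (hv.1 j hj)]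
      rw [h5]
      by_contra h6
      exact h4 ((one_add_one_eq_two (R := ℕ∞)).symm.le.trans (Order.add_one_le_of_lt (not_le.1 h6)))
    -- With a single child the equation reads `f v = 0`.
    have h6 : (finite_chi (T := T) j (par T j v)).toFinset = {v} := by
      ext w
      simp only [Set.Finite.mem_toFinset, Finset.mem_singleton]
      exact ⟨fun hw => hsub hw hmem, fun e => e ▸ hmem⟩
    rwa [h6, Finset.sum_singleton] at h3
  · exact h1 v hv

/-- For `𝓛_{u,F} ≠ 0` every `u_j` is a root or a child of a branching vertex. Bounded branching
depth then bounds the depth of `u`, and local finiteness leaves finitely many `u`. -/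
theorem finite_setOf_solSpace_ne_bot (hb : FiniteJointBranchingIndex T)
    {Ω : Finset (Fin d) → Set (∀ j, V j)} (hΩ : ∀ F, IsIndexingSet T F (Ω F)) :
    {p : Σ F : Finset (Fin d), Ω F | solSpace T (weights T c) p.1 p.2.1 ≠ ⊥}.Finite := by
  choose b hb' using fun j => (T j).exists_depth_le_of_branchingIndex (hb j)
  have hfin : (Set.univ.pi fun j => {v | (T j).depth v ≤ b j + 1}).Finite :=
    Set.Finite.pi fun j => (T j).finite_setOf_depth_le _
  let φ : (Σ F : Finset (Fin d), Ω F) → Finset (Fin d) × (∀ j, V j) := fun p => (p.1, p.2.1)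
  have hφ : Function.Injective φ := by
    rintro ⟨F, u, hu⟩ ⟨F', u', hu'⟩ h
    obtain ⟨rfl, rfl⟩ := Prod.ext_iff.1 h
    rfl
  refine Set.Finite.of_finite_image ((Set.finite_univ.prod hfin).subset ?_) hφ.injOn
  rintro _ ⟨⟨F, u, hu⟩, hp, rfl⟩
  refine ⟨trivial, fun j _ => ?_⟩
  have hu' := (hΩ F).1 hu
  change (T j).depth (u j) ≤ b j + 1
  by_cases hj : j ∈ F
  · have h1 := (T j).depth_of_adj ((T j).adj_par ((hu' j).1 hj))
    have h2 := hb' j _ (mem_branching_of_solSpace_ne_bot hl hc hu' hp hj)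
    omega
  · have h1 : u j = (T j).root := not_not.1 fun h => hj ((hu' j).2 h)
    have h2 : (T j).depth (T j).root = 0 := (T j).depth_eq (n := 0) rfl
    rw [h1, h2]
    exact Nat.zero_le _

end solutions

end TreeProduct

/-! ### Growth of the kernel coefficients and the final assembly. -/

theorem Nat.factorial_sum_le {ι : Type*} (s : Finset ι) (α : ι → ℕ) :
    -- A crude bound for multinomial coefficients: each added index contributes a binomial
    -- coefficient, at most `2` to the total.
    (∑ i ∈ s, α i).factorial ≤ (2 ^ s.card) ^ (∑ i ∈ s, α i) * ∏ i ∈ s, (α i).factorial := by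
  classical
  induction s using Finset.induction_on with
  | empty => simp
  | insert i s hi ih =>
    rw [Finset.sum_insert hi, Finset.prod_insert hi, Finset.card_insert_of_notMem hi,
      ← Nat.add_choose_mul_factorial_mul_factorial]
    calc _ ≤ 2 ^ (α i + ∑ j ∈ s, α j) * (α i).factorial *
          ((2 ^ s.card) ^ (∑ i ∈ s, α i) * ∏ i ∈ s, (α i).factorial) := by
          gcongr
          exact Nat.choose_le_two_pow _ _
      _ ≤ 2 ^ (α i + ∑ j ∈ s, α j) * (α i).factorial *
          ((2 ^ s.card) ^ (α i + ∑ i ∈ s, α i) * ∏ i ∈ s, (α i).factorial) := by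
          gcongr
          · exact Nat.one_le_two_pow
          · exact Nat.le_add_left _ _
      _ = _ := by
          rw [pow_succ 2 s.card, mul_pow]
          ring

namespace TreeProduct

variable {d : ℕ} {V : Fin d → Type u} {T : ∀ j, RootedDirectedTree (V j)}

/-- The rising product is `n!` times a binomial coefficient, at most `2 ^ (N + n)`. The denominator
absorbs `n!` at the cost of `2 ^ (d * n)`, and `c ≥ m` costs `m ^ (-n)`. -/
theorem kernelCoeff_le (hd : 0 < d) {c : ℕ → ℝ} {m : ℝ} (hm : 0 < m) (hmc : ∀ t, m ≤ c t)
    (δ α : Fin d → ℕ) :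
    kernelCoeff c δ α ≤
      ((∏ i, (δ i).factorial) * 2 ^ (∑ i, δ i + d) : ℕ) * (2 ^ (d + 1) / m) ^ ∑ i, α i := by
  set n := ∑ i, α i with hn
  set N := ∑ i, δ i + d with hN
  have h1 : ∏ j ∈ Finset.range n, ((∑ i, δ i : ℕ) + d + j : ℝ) / c ((∑ i, δ i) + j) ≤
      (2 ^ (N + n) * n.factorial : ℕ) / m ^ n := by
    have h2 : ∏ j ∈ Finset.range n, (N + j) ≤ 2 ^ (N + n) * n.factorial := by
      rw [← Nat.ascFactorial_eq_prod_range, Nat.ascFactorial_eq_factorial_mul_choose', mul_comm]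
      gcongr
      exact (Nat.choose_le_two_pow _ _).trans (Nat.pow_le_pow_right (by norm_num) (Nat.sub_le _ _))
    calc _ ≤ ∏ j ∈ Finset.range n, ((N + j : ℕ) : ℝ) / m := by
          refine Finset.prod_le_prod (fun j _ => ?_) fun j _ => ?_
          · exact div_nonneg (by positivity) (hm.le.trans (hmc _))
          · rw [hN]
            push_cast
            gcongr
            exact hmc _
      _ = ((∏ j ∈ Finset.range n, (N + j) : ℕ) : ℝ) / m ^ n := by
          rw [Finset.prod_div_distrib, Finset.prod_const, Finset.card_range, Nat.cast_prod]
      _ ≤ _ := by gcongr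
  have h3 : (n.factorial : ℝ) ≤ (2 ^ d) ^ n * (∏ i, (δ i + α i).factorial : ℕ) := by
    have h4 := Nat.factorial_sum_le Finset.univ α
    rw [Finset.card_univ, Fintype.card_fin] at h4
    have h5 : ∏ i, (α i).factorial ≤ ∏ i, (δ i + α i).factorial :=
      Finset.prod_le_prod (fun _ _ => Nat.zero_le _) fun i _ =>
        Nat.factorial_le (Nat.le_add_left _ _)
    exact_mod_cast h4.trans (Nat.mul_le_mul_left _ h5)
  have h6 : (0 : ℝ) < (∏ i, (δ i + α i).factorial : ℕ) :=
    Nat.cast_pos.2 (Finset.prod_pos fun i _ => Nat.factorial_pos _)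
  calc kernelCoeff c δ α ≤ ((∏ i, (δ i).factorial : ℕ) : ℝ) / (∏ i, (δ i + α i).factorial : ℕ) *
        ((2 ^ (N + n) * n.factorial : ℕ) / m ^ n) := by
        unfold kernelCoeff
        gcongr
    _ ≤ ((∏ i, (δ i).factorial : ℕ) : ℝ) / (∏ i, (δ i + α i).factorial : ℕ) *
        ((2 ^ (N + n) * ((2 ^ d) ^ n * (∏ i, (δ i + α i).factorial : ℕ)) : ℝ) / m ^ n) := by
        push_cast at h3 ⊢
        gcongr
    _ = _ := by
        rw [div_pow, pow_succ 2 d, mul_pow, pow_add 2 N]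
        push_cast at h6 ⊢
        field_simp

theorem summable_kernelTerm (hd : 0 < d) {c : ℕ → ℝ} {m : ℝ} (hm : 0 < m)
    (hmc : ∀ t, m ≤ c t) {r : ℝ} (hr : 0 < r) (hr1 : r * (2 ^ (d + 1) / m) * r < 1)
    (δ : Fin d → ℕ) (z w : Ball d r) : Summable (kernelTerm c δ z w) := by
  have hball : ∀ (z : Ball d r) (i : Fin d), ‖(z : EuclideanSpace ℂ (Fin d)) i‖ ≤ r :=
    fun z i => (PiLp.norm_apply_le _ i).trans (mem_ball_zero_iff.1 z.2).le
  refine Summable.of_norm_bounded ((MultiPowerSeries.summable_pow_sum d (by positivity)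
    hr1).mul_left (((∏ i, (δ i).factorial) * 2 ^ (∑ i, δ i + d) : ℕ) : ℝ)) fun α => ?_
  have h1 := MultiPowerSeries.norm_prod_pow_le (hball z) α
  have h2 := MultiPowerSeries.norm_prod_pow_le
    (z := fun i => starRingEnd ℂ ((w : EuclideanSpace ℂ (Fin d)) i)) (r := r)
    (fun i => by rw [RCLike.norm_conj]; exact hball w i) α
  have h3 := kernelCoeff_le hd hm hmc δ α
  have h4 := kernelCoeff_pos hd (fun t => hm.trans_le (hmc t)) δ α
  rw [kernelTerm, norm_mul, norm_mul, Complex.norm_real, Real.norm_of_nonneg h4.le]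
  calc _ ≤ ((((∏ i, (δ i).factorial) * 2 ^ (∑ i, δ i + d) : ℕ) : ℝ) *
        (2 ^ (d + 1) / m) ^ ∑ i, α i) * r ^ (∑ i, α i) * r ^ (∑ i, α i) := by gcongr
    _ = _ := by rw [mul_pow, mul_pow]; ring

variable {c : ℕ → ℝ} {hcs : BddAbove (Set.range c)} [∀ j, (T j).IsLocallyFinite]

/-- The indices outside `s` contribute only zero spaces, so totality survives the restriction to a
finite family. -/
theorem isWanderingSum_multishiftOf (hd : 0 < d) (hl : ∀ j, (T j).IsLeafless) {m : ℝ} (hm : 0 < m)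
    (hmc : ∀ t, m ≤ c t)
    (hS : ∀ i j, Commute (multishiftOf T c hcs i) (multishiftOf T c hcs j))
    {Ω : Finset (Fin d) → Set (∀ j, V j)} (hΩ : ∀ F, IsIndexingSet T F (Ω F))
    {s : Set (Σ F : Finset (Fin d), Ω F)} [Fintype s]
    (hs : ∀ p, p ∉ s → solSpace T (weights T c) p.1 p.2.1 = ⊥) :
    AnalyticModel.IsWanderingSum (multishiftOf T c hcs) hS (jointKernelOf T c hcs).subtypeL
      (fun p : s => solSpaceIn T (weights T c) (isBoundedWeights_weights T c hcs) p.1.1 p.1.2.1)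
      (fun p α => kernelCoeff c (depth T p.1.2.1) α) := by
  have hc : ∀ t, 0 < c t := fun t => hm.trans_le (hmc t)
  refine ⟨Subtype.val_injective, fun p α => (kernelCoeff_pos hd hc _ α).ne', ?_, ?_, ?_, ?_⟩
  · let C : s → ℝ := fun p => (((∏ i, (depth T p.1.2.1 i).factorial) *
      2 ^ (∑ i, depth T p.1.2.1 i + d) : ℕ) : ℝ)
    have hC : ∀ p, 0 ≤ C p := fun p => Nat.cast_nonneg _
    refine ⟨∑ p, C p, 2 ^ (d + 1) / m, Finset.sum_nonneg fun p _ => hC p, by positivity,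
      fun p α => ?_⟩
    rw [abs_of_pos (kernelCoeff_pos hd hc _ α)]
    refine (kernelCoeff_le hd hm hmc _ α).trans ?_
    have := Finset.single_le_sum (fun p _ => hC p) (Finset.mem_univ p)
    gcongr
  · intro p q hpq x hx y hy
    refine inner_eq_zero_of_mem_solSpace hΩ p.1.2.2 q.1.2.2 ?_ hx hy
    rintro ⟨h1, h2⟩
    apply hpq
    obtain ⟨⟨F, u, hu⟩, hp⟩ := p
    obtain ⟨⟨F', u', hu'⟩, hq⟩ := q
    obtain rfl : F = F' := h1
    obtain rfl : u = u' := h2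
    rfl
  · intro p y hy x α β
    refine inner_multiPow hl hc hS x.2 y.2 (fun v hv => ?_) α β
    by_contra h
    exact hv (hy.1 v fun h' => h (depth_of_mem_sibF h'))
  · intro f hf
    refine eq_zero_of_inner_multiPow_eq_zero hl hc hS hΩ f fun F u hu y hy α => ?_
    by_cases hp : (⟨F, u, hu⟩ : Σ F : Finset (Fin d), Ω F) ∈ s
    · exact hf ⟨_, hp⟩ ⟨y, solSpace_le_jointKernelOf hl hc ((hΩ F).1 hu) hy⟩ hy α
    · have h1 : y ∈ (⊥ : Submodule ℂ (L2 V)) := hs _ hp ▸ hy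
      rw [(Submodule.mem_bot ℂ).1 h1, map_zero, inner_zero_left]

end TreeProduct

theorem theorem2p6 {d : ℕ} (hd : 0 < d) {V : Fin d → Type u}
    (T : ∀ j, RootedDirectedTree (V j))
    (hleafless : ∀ j, (T j).IsLeafless)
    [∀ j, (T j).IsLocallyFinite]
    (hbranch : TreeProduct.FiniteJointBranchingIndex T)
    (c : ℕ → ℝ) (hcpos : ∀ t, 0 < c t) (hcinf : 0 < ⨅ t, c t)
    (hcsup : BddAbove (Set.range c))
    (Ω : Finset (Fin d) → Set (∀ j, V j))
    (hΩ : ∀ F, TreeProduct.IsIndexingSet T F (Ω F)) :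
    (∀ F, ∀ u ∈ Ω F,
      TreeProduct.solSpace T (TreeProduct.weights T c) F u ≤
        TreeProduct.jointKernelOf T c hcsup) ∧
    ∃ r : ℝ, 0 < r ∧
    ∃ (H : Type u) (_ : NormedAddCommGroup H) (_ : InnerProductSpace ℂ H) (_ : CompleteSpace H)
      (_ : RKHS ℂ H (TreeProduct.Ball d r) (TreeProduct.jointKernelOf T c hcsup)),
      -- the elements of `H` are holomorphic `E`-valued functions on the ball
      (∀ f : H, ∃ g : EuclideanSpace ℂ (Fin d) → TreeProduct.jointKernelOf T c hcsup,
        DifferentiableOn ℂ g (TreeProduct.Ball d r) ∧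
        ∀ z : TreeProduct.Ball d r, f z = g z) ∧
      -- the coordinate functions act on `H` as bounded multiplication operators, and `S_{λ_c}` is
      -- unitarily equivalent to the tuple of these operators
      (∃ M : Fin d → H →L[ℂ] H,
        (∀ (j : Fin d) (f : H) (z : TreeProduct.Ball d r),
          M j f z = (z : EuclideanSpace ℂ (Fin d)) j • f z) ∧
        ∃ U : TreeProduct.L2 V ≃ₗᵢ[ℂ] H, ∀ (j : Fin d) (x : TreeProduct.L2 V),
          U (TreeProduct.multishiftOf T c hcsup j x) = M j (U x)) ∧
      -- the reproducing kernel
      ∀ z w : TreeProduct.Ball d r,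
        (∀ F, ∀ u ∈ Ω F,
          Summable (TreeProduct.kernelTerm c (TreeProduct.depth T u) z w)) ∧
        HasSum (fun p : Σ F : Finset (Fin d), Ω F =>
            (∑' α : Fin d → ℕ, TreeProduct.kernelTerm c (TreeProduct.depth T p.2.1) z w α) •
              TreeProduct.projOf T c hcsup p.1 p.2.1)
          (RKHS.kernel H z w) := by
  have hm : ∀ t, ⨅ t, c t ≤ c t := fun t => ciInf_le ⟨0, by rintro _ ⟨t, rfl⟩; exact (hcpos t).le⟩ t
  have hS := TreeProduct.commute_multishiftOf (T := T) (hcs := hcsup) hcpos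
  have hfin := TreeProduct.finite_setOf_solSpace_ne_bot hleafless hcpos hbranch hΩ
  set s := {p : Σ F : Finset (Fin d), Ω F |
    TreeProduct.solSpace T (TreeProduct.weights T c) p.1 p.2.1 ≠ ⊥}
  have : Fintype s := hfin.fintype
  have hsum := TreeProduct.isWanderingSum_multishiftOf hd hleafless hcinf hm hS hΩ (s := s)
    fun p hp => not_not.1 hp
  obtain ⟨r₀, hr₀, hr⟩ := hsum.exists_rkhs
  set R : ℝ := 2 ^ (d + 1) / ⨅ t, c t
  have hR : 0 < R := by positivity
  -- The scalar series need `r * R * r < 1`, also where `𝓛_{u,F} = 0`; this follows from `r ≤ 1` and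
  -- `r * R < 1`.
  obtain ⟨r, hr0, hrr₀, hr1, hrR⟩ : ∃ r : ℝ, 0 < r ∧ r ≤ r₀ ∧ r ≤ 1 ∧ r * R < 1 := by
    refine ⟨min r₀ (min 1 (1 / (2 * R))), by positivity, min_le_left _ _,
      (min_le_right _ _).trans (min_le_left _ _), ?_⟩
    calc _ ≤ 1 / (2 * R) * R := by
          gcongr
          exact (min_le_right _ _).trans (min_le_right _ _)
      _ = 1 / 2 := by field_simp
      _ < 1 := by norm_num
  obtain ⟨inst, hhol, hmul, hker⟩ := hr r hr0 hrr₀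
  refine ⟨fun F u hu => TreeProduct.solSpace_le_jointKernelOf hleafless hcpos ((hΩ F).1 hu),
    r, hr0, TreeProduct.L2 V, inferInstance, inferInstance, inferInstance, inst, hhol,
    -- As the function space is `l²(V)` itself, the multiplications are the `S_j` and the unitary is
    -- the identity.
    ⟨TreeProduct.multishiftOf T c hcsup, hmul, LinearIsometryEquiv.refl ℂ _, fun j x => rfl⟩,
    fun z w => ⟨fun F u _ => ?_, ?_⟩⟩
  · exact TreeProduct.summable_kernelTerm hd hcinf hm hr0
      ((mul_le_of_le_one_right (by positivity) hr1).trans_lt hrR) _ z w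
  · rw [hker z w]
    -- The model yields a finite sum over `s`; all other projections are zero.
    refine (hasSum_subtype_iff_of_support_subset (s := s) fun p hp hps => hp ?_).1
      (hasSum_fintype _)
    have hbot : TreeProduct.solSpaceIn T (TreeProduct.weights T c)
        (TreeProduct.isBoundedWeights_weights T c hcsup) p.1 p.2.1 = ⊥ := by
      rw [TreeProduct.solSpaceIn, hps, Submodule.comap_bot, Submodule.ker_subtype]
    ext1 x
    have hx := Submodule.starProjection_apply_mem (TreeProduct.solSpaceIn T
      (TreeProduct.weights T c) (TreeProduct.isBoundedWeights_weights T c hcsup) p.1 p.2.1) x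
    have hx0 : TreeProduct.projOf T c hcsup p.1 p.2.1 x = 0 := (Submodule.mem_bot ℂ).1 (hbot ▸ hx)
    rw [_root_.smul_apply, hx0, smul_zero]
    rfl
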